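/- Let $\Bbbk$ be a field, let $m_1,m_2,m_3\ge 2$ be integers, and let $A=\Bbbk[w,x,y]/(w^{m_1},x^{m_2},y^{m_3})$, augmented by $\varepsilon:A\to\Bbbk$, $w,x,y\mapsto 0$. **The Anick resolution.** Order the words in the letters $w<x<y$ by degree, then lexicographically. A word is *normal* if its image in $A$ is not a linear combination of images of smaller words; the normal words form a basis of $A$. A *tip* is a non-normal word all of whose proper subwords are normal. Consider the quiver whose vertices are $1$ and the proper prefixes of tips, with arrows $1\to w$, $1\to x$, $1\to y$ and an arrow $f\to g$ whenever the word $gf$ contains exactly one occurrence of a tip and this occurrence is a prefix of $gf$. Let $C_n$ be the set of paths of length $n$ starting at $1$, where the path $1\to f_1\to\cdots\to f_n$ is written as $f_n\cdots f_1$, and let $C_0=\{1\}$. The Anick resolution $P_\bullet$ of $\Bbbk$ has $P_n=A\otimes_{\Bbbk}\Bbbk C_n$, with $P_0=A$ augmented by $\varepsilon$. Its $A$-linear differentials $d_n:P_n\to P_{n-1}$ are defined recursively together with maps $s_{n-1}:P_{n-1}\to P_n$: * $d_1(1\otimes v)=v$ for $v\in\{w,x,y\}$, and $s_0$ is $\Bbbk$-linear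 with $s_0(1)=0$ and $s_0(uv)=u\otimes v$ for each normal word $uv$ that ends in the letter $v$; * for $n\ge 2$ and $u=ru'\in C_n$ with last vertex $r$ and $u'\in C_{n-1}$, $d_n(1\otimes u)=r\otimes u'-s_{n-2}d_{n-1}(r\otimes u')$; * for $n\ge2$, $s_{n-1}$ vanishes on $\operatorname{im}s_{n-2}$, and on $\ker d_{n-1}$ it is given by $s_{n-1}(0)=0$ and $s_{n-1}(z)=c\,v'\otimes tu_1+s_{n-1}\bigl(z-d_n(c\,v'\otimes tu_1)\bigr)$, where $c\,r_1\otimes u_1$ ($c\in\Bbbk$, $r_1$ a normal word, $u_1\in C_{n-1}$) is the term of $z$ with the greatest word $r_1u_1$, and $r_1=v't$ is the factorization for which $tu_1\in C_n$. **Notation.** For $a\in\{1,2,3\}$ let $\sigma_a(\ell)=1$ if $\ell$ is odd and $\sigma_a(\ell)=m_a-1$ if $\ell$ is even. For $i,j,k\ge0$ let $u_{ijk}$ be the path $1\to w^{\sigma_1(1)}\to\cdots\to w^{\sigma_1(i)}\to x^{\sigma_2(1)}\to\cdots\to x^{\sigma_2(j)}\to y^{\sigma_3(1)}\to\cdots\to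 y^{\sigma_3(k)}$, and set $u_{ijk}=0$ if one of the indices is negative. **Statement.** 1. For each $n\ge 0$, $C_n$ consists of the paths $u_{ijk}$ with $i,j,k\ge0$ and $i+j+k=n$, and these are pairwise distinct. $P_\bullet$ is an augmented complex of free $A$-modules, and for all $i,j,k\ge 0$ with $n=i+j+k\ge1$, $$d_n(1\otimes u_{ijk})=y^{\sigma_3(k)}\otimes u_{i,j,k-1}+(-1)^k x^{\sigma_2(j)}\otimes u_{i,j-1,k}+(-1)^{j+k}w^{\sigma_1(i)}\otimes u_{i-1,j,k}.$$ 2. Let $A_w=\Bbbk[w]/(w^{m_1})$, $A_x=\Bbbk[x]/(x^{m_2})$, $A_y=\Bbbk[y]/(y^{m_3})$, and let $P(A_w)$ be the sequence $$\cdots\xrightarrow{w^{m_1-1}}A_w\xrightarrow{\ w\ }A_w\xrightarrow{w^{m_1-1}}A_w\xrightarrow{\ w\ }A_w\xrightarrow{\ \varepsilon\ }\Bbbk\to0,$$ with $P(A_x)$ and $P(A_y)$ defined in the same way. These are minimal free resolutions of $\Bbbk$ over $A_w$, $A_x$, $A_y$. Let $K_\bullet=\operatorname{Tot}\bigl(P(A_y)\otimes_{\Bbbk}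 P(A_x)\otimes_{\Bbbk} P(A_w)\bigr)$, an augmented complex of modules over $A_y\otimes_{\Bbbk} A_x\otimes_{\Bbbk} A_w\cong A$. Then for each $n$ there is an isomorphism of $A$-modules $\psi_n:P_n\to K_n$ such that $\psi_\bullet$ is a chain map lifting the identity map of $\Bbbk$. -/

import Mathlib

open scoped TensorProduct

noncomputable section

/-! ### Augmented algebras with an ordered generating family -/

/-- An augmented `𝕜`-algebra `A` presented as a quotient of the free algebra on the letters `ι`:
the letters map to generators of `A` on which the augmentation vanishes. The ideal of relations
is the kernel of the resulting surjection from the free algebra to `A`. -/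
structure AugPresentation (𝕜 ι A : Type*) [Field 𝕜] [Ring A] [Algebra 𝕜 A] where
  /-- the generators -/
  gen : ι → A
  /-- the augmentation -/
  aug : A →ₐ[𝕜] 𝕜
  adjoin_gen : Algebra.adjoin 𝕜 (Set.range gen) = ⊤
  aug_gen : ∀ i, aug (gen i) = 0

namespace AugPresentation

variable {𝕜 ι A : Type*} [Field 𝕜] [LinearOrder ι] [Ring A] [Algebra 𝕜 A]
variable (S : AugPresentation 𝕜 ι A)

/-- The image in `A` of a word in the letters. -/
def eval (w : List ι) : A := (w.map S.gen).prod

/-- The degree lexicographic order on words. -/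
def WordLT (v w : List ι) : Prop := List.Shortlex (· < ·) v w

/-- A word is normal if its image in `A` is not a linear combination of smaller words. -/
def IsNormal (w : List ι) : Prop :=
  S.eval w ∉ Submodule.span 𝕜 (S.eval '' {v | WordLT v w})

/-- A tip is a word that is not normal but all of whose proper (contiguous) subwords are normal. -/
def IsTip (w : List ι) : Prop :=
  ¬ S.IsNormal w ∧ ∀ v, v <:+: w → v ≠ w → S.IsNormal v

/-- The proper prefixes of tips. -/
def IsTipPrefix (r : List ι) : Prop := ∃ t, S.IsTip t ∧ r <+: t ∧ r ≠ t

/-- There is an arrow `f → g` (with `f ≠ 1`) in the quiver if `g` is a proper prefix of a tip and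
the word `gf` contains exactly one occurrence of a tip, and this occurrence is a prefix. -/
def Arrow (f g : List ι) : Prop :=
  S.IsTipPrefix g ∧ ∃ t, S.IsTip t ∧ t <+: g ++ f ∧
    ∀ p t' q, S.IsTip t' → g ++ f = p ++ t' ++ q → p = [] ∧ t' = t

/-- Paths in the quiver that start at `1`, as the list of the vertices after `1`, written from
right to left: `[h, g, f]` is the path `1 → f → g → h`. The arrows out of `1` go to the letters. -/
def IsPath : List (List ι) → Prop
  | [] => True
  | [f] => ∃ i, f = [i]
  | g :: f :: p => S.Arrow f g ∧ IsPath (f :: p)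

/-- Membership in `C_n`: the path has length `n` and starts at `1`. -/
def IsChain (n : ℕ) (p : List (List ι)) : Prop := p.length = n ∧ S.IsPath p

/-- The set `C_n`. -/
def Chain (n : ℕ) : Type _ := {p : List (List ι) // S.IsChain n p}

variable {S}

/-- The last vertex `r` of a path `u = r u'`. -/
def Chain.top {n : ℕ} (u : S.Chain (n + 1)) : List ι :=
  u.1.head (List.ne_nil_of_length_eq_add_one u.2.1)

/-- The path `u'` obtained from a path `u = r u'` by removing the last vertex. -/
def Chain.tail {n : ℕ} (u : S.Chain (n + 1)) : S.Chain n :=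
  ⟨u.1.tail, by
    obtain ⟨p, hl, hp⟩ := u
    refine ⟨by simp [hl], ?_⟩
    match p, hp with
    | [], _ => trivial
    | [f], _ => trivial
    | g :: f :: p, hp => exact hp.2⟩

/-- The word of a path: the product of its vertices. -/
def Chain.word {n : ℕ} (u : S.Chain n) : List ι := u.1.flatten

variable (S)

/-- The unique element of `C_0`. -/
def nilChain : S.Chain 0 := ⟨[], rfl, trivial⟩

/-- The element of `C_1` given by a letter. -/
def letterChain (i : ι) : S.Chain 1 := ⟨[[i]], rfl, i, rfl⟩

/-- The normal words. -/
def NormalWord : Type _ := {w : List ι // S.IsNormal w}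

theorem linearIndependent_normal :
    LinearIndependent 𝕜 (fun w : S.NormalWord => S.eval w.1) := by
  classical
  rw [linearIndependent_iff]
  intro l hl
  by_contra hne
  have hmax : ∀ s : Finset S.NormalWord, s.Nonempty →
      ∃ w ∈ s, ∀ v ∈ s, v ≠ w → WordLT v.1 w.1 := by
    intro s hs
    induction hs using Finset.Nonempty.cons_induction with
    | singleton a => exact ⟨a, by simp, by simp⟩
    | cons a s ha hs ih =>
      obtain ⟨w, hw, hmw⟩ := ih
      have trans : ∀ {a b c : List ι}, WordLT a b → WordLT b c → WordLT a c := by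
        intro a b c hab hbc
        unfold WordLT at *
        rw [List.shortlex_def] at *
        rcases hab with hab | hab <;> rcases hbc with hbc | hbc
        · left; omega
        · left; omega
        · left; omega
        · right; exact ⟨by omega, List.lt_trans (α := ι) hab.2 hbc.2⟩
      by_cases haw : WordLT a.1 w.1
      · refine ⟨w, by simp [hw], ?_⟩
        intro v hv hvw
        rcases Finset.mem_cons.1 hv with rfl | hv
        · exact haw
        · exact hmw v hv hvw
      · have hwa : WordLT w.1 a.1 := by
          by_contra h
          have := (List.Shortlex.trichotomous (r := ((· < ·) : ι → ι → Prop))).trichotomous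
            a.1 w.1 haw h
          exact ha (Subtype.ext this ▸ hw)
        refine ⟨a, by simp, ?_⟩
        intro v hv hva
        rcases Finset.mem_cons.1 hv with rfl | hv
        · exact absurd rfl hva
        · by_cases h : v = w
          · exact h ▸ hwa
          · exact trans (hmw v hv h) hwa
  obtain ⟨w, hw, hm⟩ := hmax l.support (Finsupp.support_nonempty_iff.2 hne)
  apply w.2
  rw [Finsupp.linearCombination_apply, Finsupp.sum, ← Finset.add_sum_erase _ _ hw] at hl
  have h1 : S.eval w.1 = -((l w)⁻¹ • ∑ v ∈ l.support.erase w, l v • S.eval v.1) := by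
    have h2 := eq_neg_of_add_eq_zero_left hl
    rw [← smul_neg, ← h2, inv_smul_smul₀ (Finsupp.mem_support_iff.1 hw)]
  rw [h1]
  refine Submodule.neg_mem _ (Submodule.smul_mem _ _ (Submodule.sum_mem _ fun v hv => ?_))
  rw [Finset.mem_erase] at hv
  exact Submodule.smul_mem _ _ (Submodule.subset_span ⟨v.1, hm v hv.2 hv.1, rfl⟩)

variable [Finite ι]

theorem span_normal :
    ⊤ ≤ Submodule.span 𝕜 (Set.range fun w : S.NormalWord => S.eval w.1) := by
  have hw : ∀ w : List ι,
      S.eval w ∈ Submodule.span 𝕜 (Set.range fun w : S.NormalWord => S.eval w.1) := by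
    intro w
    induction w using (List.Shortlex.wf (r := ((· < ·) : ι → ι → Prop)) wellFounded_lt).induction with
    | _ w ih =>
      by_cases hn : S.IsNormal w
      · exact Submodule.subset_span ⟨⟨w, hn⟩, rfl⟩
      · have := not_not.1 hn
        refine Submodule.span_le.2 ?_ this
        rintro _ ⟨v, hv, rfl⟩
        exact ih v hv
  have h := Algebra.adjoin_eq_span 𝕜 (Set.range S.gen)
  rw [S.adjoin_gen, Algebra.top_toSubmodule] at h
  rw [h, Submodule.span_le]
  intro a ha
  have : ∃ w : List ι, S.eval w = a := by
    induction ha using Submonoid.closure_induction with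
    | mem x hx =>
      obtain ⟨i, rfl⟩ := hx
      exact ⟨[i], by simp [eval]⟩
    | one => exact ⟨[], by simp [eval]⟩
    | mul x y _ _ hx hy =>
      obtain ⟨v, rfl⟩ := hx
      obtain ⟨w, rfl⟩ := hy
      exact ⟨v ++ w, by simp [eval]⟩
  obtain ⟨w, rfl⟩ := this
  exact hw w

/-- The basis of `A` given by the normal words. -/
def normalBasis : Module.Basis S.NormalWord 𝕜 A :=
  Module.Basis.mk S.linearIndependent_normal S.span_normal

/-! ### The Anick resolution -/

/-- The free left `A`-module `A ⊗ 𝕜 C_n`, that is, `P_n`. -/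
abbrev Free (n : ℕ) : Type _ := S.Chain n →₀ A

/-- The element `r ⊗ u` of `A ⊗ 𝕜 C_n`, for a word `r` and `u ∈ C_n`. -/
def ten {n : ℕ} (r : List ι) (u : S.Chain n) : S.Free n := Finsupp.single u (S.eval r)

/-- The coefficient of `x ∈ A ⊗ 𝕜 C_n` at the basis element `r ⊗ u`, with `r` a normal word. -/
def coeff {n : ℕ} (x : S.Free n) (r : S.NormalWord) (u : S.Chain n) : 𝕜 :=
  S.normalBasis.repr (x u) r

/-- `r ⊗ u` is the highest term of `x`, for the order of the words `ru`. -/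
def IsHighest {n : ℕ} (x : S.Free n) (r : S.NormalWord) (u : S.Chain n) : Prop :=
  S.coeff x r u ≠ 0 ∧ ∀ (r' : S.NormalWord) (u' : S.Chain n), S.coeff x r' u' ≠ 0 →
    (r', u') ≠ (r, u) → WordLT (r'.1 ++ u'.word) (r.1 ++ u.word)

/-- The recursive rule that computes the contracting homotopy on the kernel of a differential,
from the next differential `d`. The value at `0` is `0`. If the highest term of `x` is `c r₁ ⊗ u₁`,
with `r₁ = v t` for a vertex `t` such that `u = t u₁` is a path, then the value at `x` is
`c v ⊗ t u₁` plus the value at `x - d (c v ⊗ t u₁)`. -/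
inductive Reduces {n : ℕ} (d : S.Free (n + 2) →ₗ[A] S.Free (n + 1)) :
    S.Free (n + 1) → S.Free (n + 2) → Prop
  | zero : Reduces d 0 0
  | step (x : S.Free (n + 1)) (y : S.Free (n + 2)) (r : S.NormalWord) (v : List ι)
      (u : S.Chain (n + 2)) (hr : r.1 = v ++ u.top) (hx : S.IsHighest x r u.tail)
      (hy : Reduces d (x - d (S.coeff x r u.tail • S.ten v u)) y) :
      Reduces d x (S.coeff x r u.tail • S.ten v u + y)

open Classical in
/-- The value computed by the recursive rule (`0` where the rule computes none). -/
def reduce {n : ℕ} (d : S.Free (n + 2) →ₗ[A] S.Free (n + 1)) (x : S.Free (n + 1)) :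
    S.Free (n + 2) :=
  if h : ∃ y, S.Reduces d x y then h.choose else 0

/-- The value of `s_0` at a normal word: `s_0 1 = 0` and `s_0 (u vᵢ) = u ⊗ vᵢ`. -/
def sZeroWord (w : List ι) : S.Free 1 :=
  if h : w = [] then 0 else S.ten w.dropLast (S.letterChain (w.getLast h))

/-- The `𝕜`-linear map `s_0 : A → A ⊗ 𝕜 C_1`. -/
def sZero : A →ₗ[𝕜] S.Free 1 := S.normalBasis.constr 𝕜 fun w => S.sZeroWord w.1

/-- A differential `d_{n+1} : P_{n+1} → P_n` and a map `s_n : P_n → P_{n+1}`. -/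
structure Stage (n : ℕ) where
  /-- the differential -/
  d : S.Free (n + 1) →ₗ[A] S.Free n
  /-- the contracting homotopy -/
  s : S.Free n → S.Free (n + 1)

/-- The simultaneous recursive construction of the differentials and of the contracting homotopy.
In degree one, `d_1 (1 ⊗ vᵢ) = vᵢ` (where `A` is identified with `A ⊗ 𝕜 C_0`) and `s_0` is as above.
Then `d_n (1 ⊗ r u') = r ⊗ u' - s_{n-2} (d_{n-1} (r ⊗ u'))`, and `s_{n-1}` is given by the recursive
rule on `ker d_{n-1}` and by `0` on the image of `s_{n-2}`, where
`b = (b - s_{n-2} (d_{n-1} b)) + s_{n-2} (d_{n-1} b)` is the decomposition of `b` along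
`A ⊗ 𝕜 C_{n-1} = ker d_{n-1} ⊕ im s_{n-2}`. -/
def stage : (n : ℕ) → S.Stage n
  | 0 =>
    { d := Finsupp.linearCombination A fun u : S.Chain 1 => S.ten u.top S.nilChain
      s := fun x => S.sZero (x S.nilChain) }
  | n + 1 =>
    let d' : S.Free (n + 2) →ₗ[A] S.Free (n + 1) :=
      Finsupp.linearCombination A fun u : S.Chain (n + 2) =>
        S.ten u.top u.tail - (stage n).s ((stage n).d (S.ten u.top u.tail))
    { d := d'
      s := fun b => S.reduce d' (b - (stage n).s ((stage n).d b)) }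

/-- The differential `d_{n+1} : P_{n+1} → P_n` of the Anick resolution. -/
def anickD (n : ℕ) : S.Free (n + 1) →ₗ[A] S.Free n := (S.stage n).d

/-- The augmentation `P_0 = A → 𝕜` of the Anick resolution. -/
def anickAug (x : S.Free 0) : 𝕜 := S.aug (x S.nilChain)

end AugPresentation

/-! ### Truncated polynomial rings -/

/-- The exponents `σ(ℓ)` for the truncation degree `m`. -/
def truncSigma (m ℓ : ℕ) : ℕ := if Odd ℓ then 1 else m - 1

/-- The algebra `𝕜[w,x,y]/(w^{m₁}, x^{m₂}, y^{m₃})`; the variables `w, x, y` have the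
indices `0, 1, 2`, ordered as `w < x < y`. -/
abbrev TruncPoly₃ (𝕜 : Type*) [Field 𝕜] (m : Fin 3 → ℕ) : Type _ :=
  MvPolynomial (Fin 3) 𝕜 ⧸
    Ideal.span (Set.range fun a : Fin 3 => (MvPolynomial.X a ^ m a : MvPolynomial (Fin 3) 𝕜))

/-- The class of a variable in `𝕜[w,x,y]/(w^{m₁}, x^{m₂}, y^{m₃})`. -/
def truncVar₃ (𝕜 : Type*) [Field 𝕜] (m : Fin 3 → ℕ) (a : Fin 3) : TruncPoly₃ 𝕜 m :=
  Ideal.Quotient.mk _ (MvPolynomial.X a)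

/-- The algebra `𝕜[w,x,y]/(w^{m₁}, x^{m₂}, y^{m₃})` with its generators `w < x < y` and the
augmentation that vanishes on them. -/
def truncPresentation (𝕜 : Type*) [Field 𝕜] (m : Fin 3 → ℕ) (hm : ∀ a, 2 ≤ m a) :
    AugPresentation 𝕜 (Fin 3) (TruncPoly₃ 𝕜 m) where
  gen := truncVar₃ 𝕜 m
  aug := Ideal.Quotient.liftₐ _ (MvPolynomial.aeval fun _ => (0 : 𝕜)) (by
    intro p hp
    rw [← RingHom.mem_ker]
    refine Ideal.span_le.2 ?_ hp
    rintro _ ⟨a, rfl⟩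
    have : m a ≠ 0 := by have := hm a; omega
    simp [RingHom.mem_ker, this])
  adjoin_gen := by
    have h : Set.range (truncVar₃ 𝕜 m) =
        (Ideal.Quotient.mkₐ 𝕜 (Ideal.span (Set.range fun a : Fin 3 =>
          (MvPolynomial.X a ^ m a : MvPolynomial (Fin 3) 𝕜)))) '' Set.range MvPolynomial.X := by
      rw [← Set.range_comp]; rfl
    rw [h, ← AlgHom.map_adjoin, MvPolynomial.adjoin_range_X, Algebra.map_top, AlgHom.range_eq_top]
    exact Ideal.Quotient.mkₐ_surjective _ _
  aug_gen := by
    intro i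
    change (Ideal.Quotient.lift _ _ _) (Ideal.Quotient.mk _ _) = _
    simp

/-- The path `1 → a → a^{m-1} → a → ⋯` with `ℓ` vertices after `1`, all of them powers of the
letter `a`, written from right to left; the `ℓ`-th vertex is `a^{σ(ℓ)}`. -/
def powPath (a : Fin 3) (m : ℕ) : ℕ → List (List (Fin 3))
  | 0 => []
  | ℓ + 1 => List.replicate (truncSigma m (ℓ + 1)) a :: powPath a m ℓ

/-- The path `u_{ijk}`: first `i` powers of `w`, then `j` powers of `x`, then `k` powers of `y`. -/
def triPath (m : Fin 3 → ℕ) (i j k : ℕ) : List (List (Fin 3)) :=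
  powPath 2 (m 2) k ++ powPath 1 (m 1) j ++ powPath 0 (m 0) i

open Classical in
/-- The element `1 ⊗ u_{ijk}` of `P_n`, with `u_{ijk} = 0` if an index is negative. -/
def uElt (𝕜 : Type*) [Field 𝕜] (m : Fin 3 → ℕ) (hm : ∀ a, 2 ≤ m a) (n : ℕ) (i j k : ℤ) :
    (truncPresentation 𝕜 m hm).Free n :=
  if h : (0 ≤ i ∧ 0 ≤ j ∧ 0 ≤ k) ∧
      (truncPresentation 𝕜 m hm).IsChain n (triPath m i.toNat j.toNat k.toNat) then
    Finsupp.single ⟨triPath m i.toNat j.toNat k.toNat, h.2⟩ 1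
  else 0

/-! ### The periodic resolutions and their tensor product -/

/-- The truncated polynomial ring `𝕜[x]/(x^m)` in one variable. -/
abbrev TruncPoly₁ (𝕜 : Type*) [Field 𝕜] (m : ℕ) : Type _ :=
  AdjoinRoot (Polynomial.X ^ m : Polynomial 𝕜)

/-- The class of the variable in `𝕜[x]/(x^m)`. -/
def truncVar₁ (𝕜 : Type*) [Field 𝕜] (m : ℕ) : TruncPoly₁ 𝕜 m :=
  AdjoinRoot.root (Polynomial.X ^ m : Polynomial 𝕜)

/-- The augmentation of `𝕜[x]/(x^m)`, with `x ↦ 0`. -/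
def truncAug₁ (𝕜 : Type*) [Field 𝕜] (m : ℕ) (hm : 2 ≤ m) : TruncPoly₁ 𝕜 m →ₐ[𝕜] 𝕜 :=
  AdjoinRoot.liftAlgHom (Polynomial.X ^ m : Polynomial 𝕜) (Algebra.ofId 𝕜 𝕜) 0 (by
    have : m ≠ 0 := by omega
    simp [this])

/-- The differential from degree `n + 1` to degree `n` of the periodic resolution of `𝕜` over
`B = 𝕜[x]/(x^m)`, which is `B` in each degree: multiplication by `x` if `n + 1` is odd and
by `x^{m-1}` if `n + 1` is even. -/
def periodicD (𝕜 : Type*) [Field 𝕜] (m n : ℕ) :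
    TruncPoly₁ 𝕜 m →ₗ[TruncPoly₁ 𝕜 m] TruncPoly₁ 𝕜 m :=
  LinearMap.mulLeft (TruncPoly₁ 𝕜 m) (truncVar₁ 𝕜 m ^ truncSigma m (n + 1))

/-- For a local `𝕜`-algebra `B` augmented by `ε`, whose maximal ideal is `ker ε`: the sequence
`⋯ → B → B → B → 𝕜 → 0` with differentials `d n` is exact, hence a free resolution of `𝕜`, and it
is minimal, that is, each differential maps into `ker ε`. -/
def IsMinimalResolution {𝕜 B : Type*} [Field 𝕜] [CommRing B] [Algebra 𝕜 B]
    (d : ℕ → B →ₗ[B] B) (ε : B →ₐ[𝕜] 𝕜) : Prop :=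
  Function.Surjective ε ∧ Function.Exact (d 0) ε ∧ (∀ n, Function.Exact (d (n + 1)) (d n)) ∧
    ∀ n b, ε (d n b) = 0

/-- The triples `(i, j, k)` with `i + j + k = n`. -/
abbrev TriDeg (n : ℕ) : Type := {t : ℕ × ℕ × ℕ // t.1 + t.2.1 + t.2.2 = n}

section Tot

variable {𝕜 Y X W : Type*} [Field 𝕜]
  [AddCommGroup Y] [Module 𝕜 Y] [AddCommGroup X] [Module 𝕜 X] [AddCommGroup W] [Module 𝕜 W]

/-- The differential from degree `n + 1` to degree `n` of the total complex of the tensor product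
`Y ⊗ X ⊗ W` of three complexes that are constant as graded modules. In degree `n`, the total complex
is the direct sum over the finitely many triples `(i, j, k)` with `i + j + k = n` of
`Y_k ⊗ X_j ⊗ W_i`, and the differential is
`d (a ⊗ b ⊗ c) = da ⊗ b ⊗ c + (-1)^k a ⊗ db ⊗ c + (-1)^{k + j} a ⊗ b ⊗ dc`. -/
def totD (dY : ℕ → Y →ₗ[𝕜] Y) (dX : ℕ → X →ₗ[𝕜] X) (dW : ℕ → W →ₗ[𝕜] W) (n : ℕ) :
    (TriDeg (n + 1) → (Y ⊗[𝕜] X) ⊗[𝕜] W) →ₗ[𝕜] (TriDeg n → (Y ⊗[𝕜] X) ⊗[𝕜] W) :=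
  LinearMap.pi fun t : TriDeg n =>
    let i := t.1.1
    let j := t.1.2.1
    let k := t.1.2.2
    have h : i + j + k = n := t.2
    (TensorProduct.map (TensorProduct.map (dY k) LinearMap.id) LinearMap.id) ∘ₗ
        LinearMap.proj (⟨(i, j, k + 1), by change i + j + (k + 1) = n + 1; omega⟩ : TriDeg (n + 1)) +
      (-1 : 𝕜) ^ k •
        (TensorProduct.map (TensorProduct.map LinearMap.id (dX j)) LinearMap.id) ∘ₗ
          LinearMap.proj
            (⟨(i, j + 1, k), by change i + (j + 1) + k = n + 1; omega⟩ : TriDeg (n + 1)) +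
      (-1 : 𝕜) ^ (k + j) •
        (TensorProduct.map (TensorProduct.map LinearMap.id LinearMap.id) (dW i)) ∘ₗ
          LinearMap.proj
            (⟨(i + 1, j, k), by change i + 1 + j + k = n + 1; omega⟩ : TriDeg (n + 1))

/-- The augmentation `ε ⊗ ε ⊗ ε` of the total complex, in degree `0`. -/
def totAug (εY : Y →ₗ[𝕜] 𝕜) (εX : X →ₗ[𝕜] 𝕜) (εW : W →ₗ[𝕜] 𝕜) :
    (TriDeg 0 → (Y ⊗[𝕜] X) ⊗[𝕜] W) →ₗ[𝕜] 𝕜 :=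
  LinearMap.mul' 𝕜 𝕜 ∘ₗ
    TensorProduct.map (LinearMap.mul' 𝕜 𝕜 ∘ₗ TensorProduct.map εY εX) εW ∘ₗ
      LinearMap.proj (⟨(0, 0, 0), rfl⟩ : TriDeg 0)

end Tot

/-- The algebra `A_y ⊗ A_x ⊗ A_w`. -/
abbrev TruncTensor (𝕜 : Type*) [Field 𝕜] (m : Fin 3 → ℕ) : Type _ :=
  (TruncPoly₁ 𝕜 (m 2) ⊗[𝕜] TruncPoly₁ 𝕜 (m 1)) ⊗[𝕜] TruncPoly₁ 𝕜 (m 0)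

/-- The component in degree `n` of `K = Tot (P(A_y) ⊗ P(A_x) ⊗ P(A_w))`. -/
abbrev KMod (𝕜 : Type*) [Field 𝕜] (m : Fin 3 → ℕ) (n : ℕ) : Type _ :=
  TriDeg n → TruncTensor 𝕜 m

/-- The differential from degree `n + 1` to degree `n` of `K`. -/
def KD (𝕜 : Type*) [Field 𝕜] (m : Fin 3 → ℕ) (n : ℕ) : KMod 𝕜 m (n + 1) →ₗ[𝕜] KMod 𝕜 m n :=
  totD (fun l => (periodicD 𝕜 (m 2) l).restrictScalars 𝕜)
    (fun l => (periodicD 𝕜 (m 1) l).restrictScalars 𝕜)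
    (fun l => (periodicD 𝕜 (m 0) l).restrictScalars 𝕜) n

/-- The augmentation of `K`. -/
def KAug (𝕜 : Type*) [Field 𝕜] (m : Fin 3 → ℕ) (hm : ∀ a, 2 ≤ m a) : KMod 𝕜 m 0 →ₗ[𝕜] 𝕜 :=
  totAug (truncAug₁ 𝕜 (m 2) (hm 2)).toLinearMap (truncAug₁ 𝕜 (m 1) (hm 1)).toLinearMap
    (truncAug₁ 𝕜 (m 0) (hm 0)).toLinearMap

end

/-! ### Words and monomials -/

/-! The relations of `A` are commutativity and the monomials `a ^ m a`, so a word is normal exactly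
when it is sorted and each letter `a` occurs fewer than `m a` times (`isNormal_iff`). The tips are
therefore the words `ca` with `a < c` and the powers `a ^ m a` (`isTip_iff`), and from a vertex `a ^
b` one can only go to `a ^ (m a - b)` or to a larger letter (`arrow_iff`). This forces every path
from `1` to be some `u_{ijk}`.

The formula for the differential is proved by induction on the degree (`hasFormula_stage`). Write `u
= r u'`, where `r` is a power of the largest letter occurring in `u`. In `d (r ⊗ u')` the term in
the direction of that letter dies, because consecutive exponents add up to `m a`; at most two terms
are left. On these the recursive rule stops after at most two steps (`reduces_boundary_right`,
`reduces_boundary_mid`): each step moves the last block of the coefficient into the path, and the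
terms this creates cancel by the signs of a triple complex. The rule is deterministic
(`Reduces.unique`), so exhibiting such a trace computes `s`. The formulas in two consecutive degrees
give `d d = 0`, which puts the boundaries in the kernel, where `s` is the rule itself.

For the comparison with the tensor product, the formula says that in coordinates the Anick
differential is `triD` with entries `a ^ σ(l)`. The total differential is `triD` with the
corresponding entries of `A_y ⊗ A_x ⊗ A_w` (`KD_eq_triD`), and a ring homomorphism applied entrywise
commutes with `triD` (`triD_map`). So the algebra isomorphism, applied in each coordinate, is a
chain isomorphism. -/

/-- A sorted word is not greater than any of its rearrangements. -/
theorem List.Perm.not_lt_of_pairwise_le {α : Type*} [LinearOrder α] {v w : List α}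
    (h : v.Perm w) (hw : w.Pairwise (· ≤ ·)) : ¬ v < w := by
  induction w generalizing v with
  | nil => simp
  | cons a w ih =>
    cases v with
    | nil => simp at h
    | cons b v =>
      rw [List.pairwise_cons] at hw
      rw [List.cons_lt_cons_iff]
      rintro (hba | ⟨rfl, hvw⟩)
      · have hb : b ∈ a :: w := h.subset (by simp)
        rcases List.mem_cons.1 hb with rfl | hb
        · exact lt_irrefl _ hba
        · exact absurd (hw.1 b hb) (not_le.2 hba)
      · exact ih (List.Perm.cons_inv h) hw.2 hvw

theorem truncSigma_pos {m : ℕ} (hm : 2 ≤ m) (l : ℕ) : 0 < truncSigma m l := by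
  unfold truncSigma; split <;> omega

theorem truncSigma_lt {m : ℕ} (hm : 2 ≤ m) (l : ℕ) : truncSigma m l < m := by
  unfold truncSigma; split <;> omega

/-- Of two consecutive exponents one is `1` and the other `m - 1`. This one fact gives the arrows
between powers of a letter, the vanishing of `d d` in each direction, and the exactness of the
periodic complexes. -/
theorem truncSigma_succ_add {m : ℕ} (hm : 2 ≤ m) (l : ℕ) :
    truncSigma m (l + 1) + truncSigma m l = m := by
  unfold truncSigma
  by_cases h : Odd l
  · have : ¬ Odd (l + 1) := by rw [Nat.odd_add_one]; simpa using h
    simp only [h, this, if_true, if_false]; omega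
  · have : Odd (l + 1) := by rw [Nat.odd_add_one]; simpa using h
    simp only [h, this, if_true, if_false]; omega

@[simp]
theorem truncSigma_one (m : ℕ) : truncSigma m 1 = 1 := by simp [truncSigma]

theorem truncVar₃_pow (𝕜 : Type*) [Field 𝕜] (m : Fin 3 → ℕ) (a : Fin 3) :
    truncVar₃ 𝕜 m a ^ m a = 0 := by
  rw [truncVar₃, ← map_pow, Ideal.Quotient.eq_zero_iff_mem]
  exact Ideal.subset_span ⟨a, rfl⟩

namespace TruncAnick

variable {𝕜 : Type*} [Field 𝕜] {m : Fin 3 → ℕ} {hm : ∀ a, 2 ≤ m a}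

/-- The exponent vector of a word. -/
noncomputable def wordExp (w : List (Fin 3)) : Fin 3 →₀ ℕ :=
  Finsupp.equivFunOnFinite.symm fun a => w.count a

@[simp]
theorem wordExp_apply (w : List (Fin 3)) (a : Fin 3) : wordExp w a = w.count a := rfl

theorem wordExp_cons (a : Fin 3) (w : List (Fin 3)) :
    wordExp (a :: w) = Finsupp.single a 1 + wordExp w := by
  ext b
  simp [List.count_cons, Finsupp.single_apply, add_comm]

theorem eval_eq_mk_monomial (w : List (Fin 3)) :
    (truncPresentation 𝕜 m hm).eval w =
      Ideal.Quotient.mk _ (MvPolynomial.monomial (wordExp w) (1 : 𝕜)) := by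
  induction w with
  | nil =>
    have : wordExp [] = 0 := by ext; simp
    simp [AugPresentation.eval, this]
  | cons a w ih =>
    have h1 : (truncPresentation 𝕜 m hm).eval (a :: w) =
      truncVar₃ 𝕜 m a * (truncPresentation 𝕜 m hm).eval w := by
      simp [AugPresentation.eval, truncPresentation]
    rw [h1, ih, wordExp_cons, truncVar₃, ← map_mul, MvPolynomial.X, MvPolynomial.monomial_mul,
      one_mul]

/-- The ideal is monomial, so every monomial occurring in one of its elements is divisible by some
`X a ^ m a`. -/
theorem coeff_eq_zero_of_mem {p : MvPolynomial (Fin 3) 𝕜}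
    (hp : p ∈ Ideal.span (Set.range fun a : Fin 3 =>
      (MvPolynomial.X a ^ m a : MvPolynomial (Fin 3) 𝕜)))
    {e : Fin 3 →₀ ℕ} (he : ∀ a, e a < m a) : p.coeff e = 0 := by
  have h : (Set.range fun a : Fin 3 => (MvPolynomial.X a ^ m a : MvPolynomial (Fin 3) 𝕜)) =
      (fun s => MvPolynomial.monomial s (1 : 𝕜)) ''
        Set.range (fun a : Fin 3 => Finsupp.single a (m a)) := by
    rw [← Set.range_comp]
    congr 1
    ext1 a
    simp [MvPolynomial.X_pow_eq_monomial]
  rw [h, MvPolynomial.mem_ideal_span_monomial_image] at hp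
  by_contra hne
  obtain ⟨_, ⟨a, rfl⟩, hle⟩ := hp e (MvPolynomial.mem_support_iff.2 hne)
  have := hle a
  simp only [Finsupp.single_eq_same] at this
  exact absurd (he a) (not_lt.2 this)

/-- The normal words are the sorted words in which the letter `a` occurs less than `m a` times. -/
theorem isNormal_iff (w : List (Fin 3)) :
    (truncPresentation 𝕜 m hm).IsNormal w ↔
      w.Pairwise (· ≤ ·) ∧ ∀ a, w.count a < m a := by
  constructor
  · intro h
    refine ⟨?_, ?_⟩
    -- An unsorted word has the same image as its sorted rearrangement, which is smaller.
    · by_contra hw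
      apply h
      have hp : (w.mergeSort (· ≤ ·)).Perm w := List.mergeSort_perm _ _
      have hs : (w.mergeSort (· ≤ ·)).Pairwise (· ≤ ·) := by
        exact List.pairwise_mergeSort' _ _
      refine Submodule.subset_span ⟨w.mergeSort (· ≤ ·), ?_, ?_⟩
      · refine (List.shortlex_def ..).2 (Or.inr ⟨hp.length_eq, ?_⟩)
        have h1 : ¬ w < w.mergeSort (· ≤ ·) := hp.symm.not_lt_of_pairwise_le hs
        have h2 : w.mergeSort (· ≤ ·) ≠ w := fun h => hw (h ▸ hs)
        exact lt_of_le_of_ne (not_lt.1 h1) h2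
      · rw [eval_eq_mk_monomial, eval_eq_mk_monomial]
        have he : wordExp (w.mergeSort (· ≤ ·)) = wordExp w := by
          ext a
          simp [hp.count_eq]
        rw [he]
    · by_contra! hw
      obtain ⟨a, ha⟩ := hw
      apply h
      have : (truncPresentation 𝕜 m hm).eval w = 0 := by
        rw [eval_eq_mk_monomial, Ideal.Quotient.eq_zero_iff_mem]
        have he : wordExp w = Finsupp.single a (m a) + (wordExp w - Finsupp.single a (m a)) := by
          refine (add_tsub_cancel_of_le ?_).symm
          rw [Finsupp.single_le_iff]
          exact ha
        rw [he, ← one_mul (1 : 𝕜), ← MvPolynomial.monomial_mul, ← MvPolynomial.X_pow_eq_monomial]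
        exact Ideal.mul_mem_right _ _ (Ideal.subset_span ⟨a, rfl⟩)
      rw [this]
      exact Submodule.zero_mem _
  · rintro ⟨hs, hc⟩ h
    -- A relation expressing `w` by smaller words lifts to a polynomial `p` whose difference from
    -- the monomial of `w` lies in the ideal. The contradiction comes from the coefficient at the
    -- exponent of `w`: it is `0` in the difference by `hc`, `1` in the monomial, and `0` in `p`,
    -- since a word with that exponent is a rearrangement of the sorted word `w` and so not smaller.
    let q := (Ideal.Quotient.mkₐ 𝕜 (Ideal.span (Set.range fun a : Fin 3 =>
          (MvPolynomial.X a ^ m a : MvPolynomial (Fin 3) 𝕜)))).toLinearMap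
    have himg : (truncPresentation 𝕜 m hm).eval '' {v | AugPresentation.WordLT v w} =
        q '' ((fun v => MvPolynomial.monomial (wordExp v) (1 : 𝕜)) ''
          {v | AugPresentation.WordLT v w}) := by
      rw [Set.image_image]
      refine Set.image_congr fun v _ => eval_eq_mk_monomial v
    rw [himg, Submodule.span_image] at h
    obtain ⟨p, hp, hpe⟩ := h
    rw [eval_eq_mk_monomial] at hpe
    have hmem := (Ideal.Quotient.eq (I := Ideal.span (Set.range fun a : Fin 3 =>
          (MvPolynomial.X a ^ m a : MvPolynomial (Fin 3) 𝕜)))).1 hpe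
    have h0 := coeff_eq_zero_of_mem hmem (e := wordExp w) hc
    have hp0 : p.coeff (wordExp w) = 0 := by
      have hle : Submodule.span 𝕜 ((fun v => MvPolynomial.monomial (wordExp v) (1 : 𝕜)) ''
          {v | AugPresentation.WordLT v w}) ≤ LinearMap.ker (MvPolynomial.lcoeff 𝕜 (wordExp w)) := by
        rw [Submodule.span_le]
        rintro _ ⟨v, hv, rfl⟩
        simp only [SetLike.mem_coe, LinearMap.mem_ker, MvPolynomial.lcoeff_apply,
          MvPolynomial.coeff_monomial, ite_eq_right_iff, one_ne_zero, imp_false]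
        intro he
        have hperm : v.Perm w := by
          rw [List.perm_iff_count]
          intro a
          exact DFunLike.congr_fun he a
        rcases (List.shortlex_def ..).1 hv with hv | hv
        · exact absurd hperm.length_eq hv.ne
        · exact hperm.not_lt_of_pairwise_le hs hv.2
      exact hle hp
    rw [MvPolynomial.coeff_sub, hp0, MvPolynomial.coeff_monomial, if_pos rfl, zero_sub] at h0
    exact one_ne_zero (neg_eq_zero.1 h0)

theorem IsNormal.of_infix {v w : List (Fin 3)} (hw : (truncPresentation 𝕜 m hm).IsNormal w)
    (h : v <:+: w) : (truncPresentation 𝕜 m hm).IsNormal v := by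
  rw [isNormal_iff] at *
  exact ⟨hw.1.sublist h.sublist, fun a => (h.sublist.count_le a).trans_lt (hw.2 a)⟩

/-! ### Tips -/

theorem isNormal_replicate {a : Fin 3} {e : ℕ} (he : e < m a) :
    (truncPresentation 𝕜 m hm).IsNormal (List.replicate e a) := by
  rw [isNormal_iff]
  refine ⟨List.pairwise_replicate.2 (Or.inr le_rfl), fun b => ?_⟩
  rw [List.count_replicate]
  split_ifs with h
  · rw [← beq_iff_eq.1 h]; exact he
  · have := hm b; omega

theorem isTip_replicate (a : Fin 3) :
    (truncPresentation 𝕜 m hm).IsTip (List.replicate (m a) a) := by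
  refine ⟨fun h => ?_, fun v hv hne => ?_⟩
  · have := ((isNormal_iff _).1 h).2 a
    simp at this
  · obtain ⟨hl, h⟩ := List.infix_replicate_iff.1 hv
    rw [h]
    refine isNormal_replicate (lt_of_le_of_ne hl fun h' => hne (by rw [h, h']))

theorem isTip_pair {a c : Fin 3} (h : a < c) : (truncPresentation 𝕜 m hm).IsTip [c, a] := by
  refine ⟨fun hn => ?_, fun v hv hne => ?_⟩
  · have := ((isNormal_iff _).1 hn).1
    simp at this
    exact absurd h (not_lt.2 this)
  · have hl := hv.length_le
    have : v.length < 2 := lt_of_le_of_ne hl fun h => hne (hv.eq_of_length h)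
    match v, this with
    | [], _ => exact isNormal_replicate (a := 0) (e := 0) (by have := hm 0; omega)
    | [b], _ => exact isNormal_replicate (a := b) (e := 1) (by have := hm b; omega)

theorem IsTip.eq_of_infix {s t : List (Fin 3)} (hs : (truncPresentation 𝕜 m hm).IsTip s)
    (ht : (truncPresentation 𝕜 m hm).IsTip t) (h : s <:+: t) : s = t := by
  by_contra hne
  exact hs.1 (ht.2 s h hne)

theorem exists_infix_pair_of_not_pairwise {w : List (Fin 3)} (h : ¬ w.Pairwise (· ≤ ·)) :
    ∃ a c, a < c ∧ [c, a] <:+: w := by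
  rw [← List.isChain_iff_pairwise, List.isChain_iff_forall_rel_of_append_cons_cons] at h
  push Not at h
  obtain ⟨c, a, l₁, l₂, rfl, hac⟩ := h
  exact ⟨a, c, hac, l₁, l₂, by simp⟩

theorem replicate_count_prefix {a : Fin 3} {w : List (Fin 3)} (hw : w.Pairwise (· ≤ ·))
    (ha : ∀ b ∈ w, a ≤ b) : List.replicate (w.count a) a <+: w := by
  induction w with
  | nil => simp
  | cons b w ih =>
    rw [List.pairwise_cons] at hw
    by_cases hb : b = a
    · subst hb
      rw [List.count_cons_self, List.replicate_succ, List.cons_prefix_cons]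
      exact ⟨rfl, ih hw.2 hw.1⟩
    · have : (b :: w).count a = 0 := by
        rw [List.count_eq_zero]
        intro hmem
        rcases List.mem_cons.1 hmem with h | h
        · exact hb h.symm
        · exact hb (le_antisymm (hw.1 a h) (ha b (by simp)))
      rw [this]
      simp

/-- In a sorted word the occurrences of one letter form a single block. -/
theorem replicate_count_infix {a : Fin 3} {w : List (Fin 3)} (hw : w.Pairwise (· ≤ ·)) :
    List.replicate (w.count a) a <:+: w := by
  induction w with
  | nil => simp
  | cons b w ih =>
    by_cases hb : a ≤ b
    · refine (replicate_count_prefix hw fun c hc => ?_).isInfix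
      rcases List.mem_cons.1 hc with rfl | hc
      · exact hb
      · exact hb.trans ((List.pairwise_cons.1 hw).1 c hc)
    · rw [List.count_cons_of_ne (by rintro rfl; exact hb le_rfl)]
      exact (ih (List.pairwise_cons.1 hw).2).trans (List.suffix_cons b w).isInfix

/-- The tips are the words `ca` with `a < c` and `a ^ m a`. -/
theorem isTip_iff (t : List (Fin 3)) :
    (truncPresentation 𝕜 m hm).IsTip t ↔
      (∃ a c, a < c ∧ t = [c, a]) ∨ ∃ a, t = List.replicate (m a) a := by
  constructor
  · intro ht
    by_cases hs : t.Pairwise (· ≤ ·)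
    · right
      have hn := ht.1
      rw [isNormal_iff] at hn
      push Not at hn
      obtain ⟨a, ha⟩ := hn hs
      refine ⟨a, ?_⟩
      have hsub : List.replicate (m a) a <:+: t := by
        refine List.IsInfix.trans ?_ (replicate_count_infix (a := a) hs)
        rw [List.infix_replicate_iff]
        simpa using ha
      exact (IsTip.eq_of_infix (isTip_replicate a) ht hsub).symm
    · left
      obtain ⟨a, c, hac, hi⟩ := exists_infix_pair_of_not_pairwise hs
      exact ⟨a, c, hac, (IsTip.eq_of_infix (isTip_pair hac) ht hi).symm⟩
  · rintro (⟨a, c, h, rfl⟩ | ⟨a, rfl⟩)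
    · exact isTip_pair h
    · exact isTip_replicate a

/-! ### The quiver and its paths -/

theorem IsTipPrefix.eq_replicate {g : List (Fin 3)}
    (h : (truncPresentation 𝕜 m hm).IsTipPrefix g) :
    ∃ c e, e < m c ∧ g = List.replicate e c := by
  obtain ⟨t, ht, hp, hne⟩ := h
  have hl : g.length < t.length :=
    lt_of_le_of_ne hp.length_le fun h => hne (hp.eq_of_length h)
  rcases (isTip_iff t).1 ht with ⟨a, c, -, rfl⟩ | ⟨a, rfl⟩
  · match g, hl, hp with
    | [], _, _ => exact ⟨c, 0, by have := hm c; omega, rfl⟩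
    | [b], _, _ => exact ⟨b, 1, by have := hm b; omega, rfl⟩
  · refine ⟨a, g.length, by simpa using hl, ?_⟩
    exact (List.prefix_replicate_iff.1 hp).2

/-- An occurrence of a tip that misses the first letter would lie in the normal word `f`. Two tips
that are both prefixes are comparable, hence equal by minimality. This is the uniqueness clause in
`Arrow`. -/
theorem IsTip.unique_of_isNormal {t f : List (Fin 3)} {c : Fin 3}
    (ht : (truncPresentation 𝕜 m hm).IsTip t)
    (hf : (truncPresentation 𝕜 m hm).IsNormal f) (htf : t <+: c :: f)
    {p t' q : List (Fin 3)} (ht' : (truncPresentation 𝕜 m hm).IsTip t')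
    (h : c :: f = p ++ t' ++ q) : p = [] ∧ t' = t := by
  cases p with
  | nil =>
    refine ⟨rfl, ?_⟩
    have h' : t' <+: c :: f := ⟨q, by simpa using h.symm⟩
    rcases List.prefix_or_prefix_of_prefix h' htf with h | h
    · exact IsTip.eq_of_infix ht' ht h.isInfix
    · exact (IsTip.eq_of_infix ht ht' h.isInfix).symm
  | cons b p =>
    simp only [List.cons_append, List.cons.injEq] at h
    exact absurd (IsNormal.of_infix hf ⟨p, q, h.2.symm⟩) ht'.1

/-- The arrows out of the vertex `a ^ b`. -/
theorem arrow_iff {a : Fin 3} {b : ℕ} (hb : 0 < b) (hba : b < m a) (g : List (Fin 3)) :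
    (truncPresentation 𝕜 m hm).Arrow (List.replicate b a) g ↔
      g = List.replicate (m a - b) a ∨ ∃ c, a < c ∧ g = [c] := by
  constructor
  · rintro ⟨hg, t, ht, htp, huniq⟩
    obtain ⟨c, e, he, rfl⟩ := IsTipPrefix.eq_replicate hg
    have hnot : ¬ (truncPresentation 𝕜 m hm).IsNormal
        (List.replicate e c ++ List.replicate b a) :=
      fun h => ht.1 (IsNormal.of_infix h htp.isInfix)
    rcases lt_trichotomy c a with hca | rfl | hca
    · refine absurd ?_ hnot
      rw [isNormal_iff]
      refine ⟨?_, fun d => ?_⟩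
      · rw [List.pairwise_append]
        refine ⟨List.pairwise_replicate.2 (Or.inr le_rfl),
          List.pairwise_replicate.2 (Or.inr le_rfl), fun x hx y hy => ?_⟩
        rw [List.eq_of_mem_replicate hx, List.eq_of_mem_replicate hy]
        exact hca.le
      · rw [List.count_append, List.count_replicate, List.count_replicate]
        have := hm d
        by_cases h1 : c = d
        · subst h1
          have : ¬ a = c := hca.ne'
          simp [this, he]
        · by_cases h2 : a = d
          · subst h2
            simp [h1, hba]
          · simp [h1, h2]; omega
    · left
      rw [← List.replicate_add] at hnot huniq
      have h1 : m c ≤ e + b := by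
        by_contra! h
        exact hnot (isNormal_replicate h)
      have h2 : e + b = m c := by
        -- If `e + b > m c`, then `c ^ m c` also occurs one letter further to the right.
        by_contra h
        have := huniq [c] (List.replicate (m c) c) (List.replicate (e + b - m c - 1) c)
          (isTip_replicate c) (by
            rw [← List.replicate_one, ← List.replicate_add, ← List.replicate_add]
            congr 1
            omega)
        exact absurd this.1 (by simp)
      congr 1
      omega
    · right
      refine ⟨c, hca, ?_⟩
      obtain ⟨b, rfl⟩ : ∃ b', b = b' + 1 := ⟨b - 1, by omega⟩
      cases e with
      | zero => exact absurd (by simpa using isNormal_replicate hba) hnot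
      | succ e =>
        -- The tip `ca` at the junction of the two powers must itself be the prefix, which leaves a
        -- single `c`.
        have := huniq (List.replicate e c) [c, a] (List.replicate b a) (isTip_pair hca) (by
          rw [List.replicate_succ', List.replicate_succ]; simp)
        have he : e = 0 := by simpa using this.1
        simp [he]
  · rintro (rfl | ⟨c, hc, rfl⟩)
    · obtain ⟨e, he⟩ : ∃ e, m a - b = e + 1 := ⟨m a - b - 1, by omega⟩
      refine ⟨⟨List.replicate (m a) a, isTip_replicate a, ?_, ?_⟩,
        List.replicate (m a) a, isTip_replicate a, ?_, ?_⟩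
      · rw [List.prefix_replicate_iff]; simp
      · intro h
        have := congrArg List.length h
        simp at this
        omega
      · rw [← List.replicate_add]
        exact List.prefix_replicate_iff.2 ⟨by simp; omega, by simp⟩
      · intro p t' q ht' h
        have h1 : List.replicate (m a - b) a ++ List.replicate b a =
            a :: List.replicate (m a - 1) a := by
          rw [← List.replicate_add, ← List.replicate_succ]
          congr 1
          omega
        rw [h1] at h
        refine IsTip.unique_of_isNormal (isTip_replicate a) (isNormal_replicate ?_) ?_ ht' h
        · have := hm a; omega
        · rw [← List.replicate_succ]
          exact List.prefix_replicate_iff.2 ⟨by simp; omega, by simp⟩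
    · obtain ⟨b, rfl⟩ : ∃ b', b = b' + 1 := ⟨b - 1, by omega⟩
      refine ⟨⟨[c, a], isTip_pair hc, ⟨[a], rfl⟩, by simp⟩, [c, a], isTip_pair hc,
        ⟨List.replicate b a, by simp [List.replicate_succ]⟩, fun p t' q ht' h => ?_⟩
      exact IsTip.unique_of_isNormal (isTip_pair hc) (isNormal_replicate hba)
        ⟨List.replicate b a, by simp [List.replicate_succ]⟩ ht' h

/-! ### The paths `u_{ijk}`: distinctness and exhaustion -/

theorem triPath_succ_right (m : Fin 3 → ℕ) (i j k : ℕ) :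
    triPath m i j (k + 1) = List.replicate (truncSigma (m 2) (k + 1)) 2 :: triPath m i j k := rfl

theorem triPath_succ_mid (m : Fin 3 → ℕ) (i j : ℕ) :
    triPath m i (j + 1) 0 = List.replicate (truncSigma (m 1) (j + 1)) 1 :: triPath m i j 0 := rfl

theorem triPath_succ_left (m : Fin 3 → ℕ) (i : ℕ) :
    triPath m (i + 1) 0 0 = List.replicate (truncSigma (m 0) (i + 1)) 0 :: triPath m i 0 0 := rfl

theorem length_powPath (a : Fin 3) (m l : ℕ) : (powPath a m l).length = l := by
  induction l with
  | zero => rfl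
  | succ l ih => simp [powPath, ih]

theorem length_triPath (m : Fin 3 → ℕ) (i j k : ℕ) : (triPath m i j k).length = i + j + k := by
  simp [triPath, length_powPath]; omega

/-- The vertices are nonempty, so counting them by first letter recovers `i`, `j`, `k` from the
path. -/
theorem countP_powPath {m : ℕ} (hm : 2 ≤ m) (a b : Fin 3) (l : ℕ) :
    (powPath a m l).countP (fun f => f.head? == some b) = if a = b then l else 0 := by
  induction l with
  | zero => simp [powPath]
  | succ l ih =>
    obtain ⟨e, he⟩ := Nat.exists_eq_succ_of_ne_zero (truncSigma_pos hm (l + 1)).ne'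
    rw [powPath, List.countP_cons, ih, he]
    by_cases h : a = b <;> simp [h, List.replicate_succ]

theorem triPath_injective (hm : ∀ a, 2 ≤ m a) {i j k i' j' k' : ℕ}
    (h : triPath m i j k = triPath m i' j' k') : i = i' ∧ j = j' ∧ k = k' := by
  have key := fun b => congrArg (List.countP (fun f => f.head? == some b)) h
  simp only [triPath, List.countP_append, countP_powPath (hm _)] at key
  have h0 := key 0
  have h1 := key 1
  have h2 := key 2
  simp at h0 h1 h2
  exact ⟨h0, h1, h2⟩

theorem replicate_sub_truncSigma (hm : ∀ a, 2 ≤ m a) (a : Fin 3) (l : ℕ) :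
    List.replicate (m a - truncSigma (m a) l) a =
      List.replicate (truncSigma (m a) (l + 1)) a := by
  have := truncSigma_succ_add (hm a) l
  congr 1
  omega

theorem isPath_triPath (i j k : ℕ) : (truncPresentation 𝕜 m hm).IsPath (triPath m i j k) := by
  have harrow : ∀ (a : Fin 3) (l : ℕ), (truncPresentation 𝕜 m hm).Arrow
      (List.replicate (truncSigma (m a) l) a)
      (List.replicate (truncSigma (m a) (l + 1)) a) := fun a l =>
    (arrow_iff (truncSigma_pos (hm a) l) (truncSigma_lt (hm a) l) _).2
      (Or.inl (replicate_sub_truncSigma hm a l).symm)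
  have harrow' : ∀ (a c : Fin 3) (l : ℕ), a < c → (truncPresentation 𝕜 m hm).Arrow
      (List.replicate (truncSigma (m a) l) a) (List.replicate (truncSigma (m c) 1) c) :=
    fun a c l h => (arrow_iff (truncSigma_pos (hm a) l) (truncSigma_lt (hm a) l) _).2
      (Or.inr ⟨c, h, by simp⟩)
  induction k with
  | zero =>
    induction j with
    | zero =>
      induction i with
      | zero => trivial
      | succ i ih =>
        cases i with
        | zero => exact ⟨0, by simp⟩
        | succ i => exact ⟨harrow 0 _, ih⟩
    | succ j ih =>
      cases j with
      | zero =>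
        cases i with
        | zero => exact ⟨1, by simp⟩
        | succ i => exact ⟨harrow' 0 1 _ (by decide), ih⟩
      | succ j => exact ⟨harrow 1 _, ih⟩
  | succ k ih =>
    cases k with
    | zero =>
      cases j with
      | zero =>
        cases i with
        | zero => exact ⟨2, by simp⟩
        | succ i => exact ⟨harrow' 0 2 _ (by decide), ih⟩
      | succ j => exact ⟨harrow' 1 2 _ (by decide), ih⟩
    | succ k => exact ⟨harrow 2 _, ih⟩

/-- The letter of the last vertex decides how a path can grow: a power of `y` only continues with
`y`, a power of `x` with `x` or `y`, a power of `w` with any letter. A change of letter restarts at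
exponent `σ(1) = 1`. -/
theorem IsPath.exists_triPath {p : List (List (Fin 3))}
    (hp : (truncPresentation 𝕜 m hm).IsPath p) : ∃ i j k, p = triPath m i j k := by
  induction p with
  | nil => exact ⟨0, 0, 0, rfl⟩
  | cons g p ih =>
    cases p with
    | nil =>
      obtain ⟨a, rfl⟩ := hp
      fin_cases a
      · exact ⟨1, 0, 0, by simp [triPath, powPath]⟩
      · exact ⟨0, 1, 0, by simp [triPath, powPath]⟩
      · exact ⟨0, 0, 1, by simp [triPath, powPath]⟩
    | cons f p =>
      obtain ⟨harr, hp⟩ := hp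
      obtain ⟨i, j, k, h⟩ := ih hp
      rw [h]
      cases k with
      | succ k =>
        rw [triPath_succ_right, List.cons.injEq] at h
        rw [h.1, arrow_iff (truncSigma_pos (hm 2) _) (truncSigma_lt (hm 2) _),
          replicate_sub_truncSigma hm] at harr
        rcases harr with rfl | ⟨c, hc, rfl⟩
        · exact ⟨i, j, k + 2, rfl⟩
        · exact absurd hc (by fin_cases c <;> decide)
      | zero =>
        cases j with
        | succ j =>
          rw [triPath_succ_mid, List.cons.injEq] at h
          rw [h.1, arrow_iff (truncSigma_pos (hm 1) _) (truncSigma_lt (hm 1) _),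
            replicate_sub_truncSigma hm] at harr
          rcases harr with rfl | ⟨c, hc, rfl⟩
          · exact ⟨i, j + 2, 0, rfl⟩
          · obtain rfl : c = 2 := by revert hc; fin_cases c <;> decide
            exact ⟨i, j + 1, 1, by simp [triPath_succ_right]⟩
        | zero =>
          cases i with
          | succ i =>
            rw [triPath_succ_left, List.cons.injEq] at h
            rw [h.1, arrow_iff (truncSigma_pos (hm 0) _) (truncSigma_lt (hm 0) _),
              replicate_sub_truncSigma hm] at harr
            rcases harr with rfl | ⟨c, hc, rfl⟩
            · exact ⟨i + 2, 0, 0, rfl⟩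
            · obtain rfl | rfl : c = 1 ∨ c = 2 := by revert hc; fin_cases c <;> decide
              · exact ⟨i + 1, 1, 0, by simp [triPath_succ_mid]⟩
              · exact ⟨i + 1, 0, 1, by simp [triPath_succ_right]⟩
          | zero => simp [triPath, powPath] at h

theorem isChain_triPath {n i j k : ℕ} (h : i + j + k = n) :
    (truncPresentation 𝕜 m hm).IsChain n (triPath m i j k) :=
  ⟨by rw [length_triPath, h], isPath_triPath i j k⟩

theorem isChain_iff (n : ℕ) (p : List (List (Fin 3))) :
    (truncPresentation 𝕜 m hm).IsChain n p ↔
      ∃! t : TriDeg n, p = triPath m t.1.1 t.1.2.1 t.1.2.2 := by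
  constructor
  · rintro ⟨hl, hp⟩
    obtain ⟨i, j, k, rfl⟩ := IsPath.exists_triPath hp
    rw [length_triPath] at hl
    refine ⟨⟨(i, j, k), hl⟩, rfl, ?_⟩
    rintro ⟨⟨i', j', k'⟩, h'⟩ h
    obtain ⟨rfl, rfl, rfl⟩ := triPath_injective hm h
    rfl
  · rintro ⟨⟨⟨i, j, k⟩, h⟩, rfl, -⟩
    exact isChain_triPath h

end TruncAnick

/-! ### The recursive rule of the Anick resolution -/

namespace AugPresentation

variable {𝕜 ι A : Type*} [Field 𝕜] [LinearOrder ι] [Ring A] [Algebra 𝕜 A]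
variable {S : AugPresentation 𝕜 ι A}

theorem WordLT.asymm {v w : List ι} (h : WordLT v w) : ¬ WordLT w v := by
  unfold WordLT at *
  rw [List.shortlex_def] at *
  rintro (h' | h') <;> rcases h with h | h
  · omega
  · omega
  · omega
  · exact List.lt_asymm (α := ι) h.2 h'.2

theorem WordLT.ne {v w : List ι} (h : WordLT v w) : v ≠ w := by
  rintro rfl
  exact h.asymm h

theorem Chain.cons_top_tail {n : ℕ} (u : S.Chain (n + 1)) : u.1 = u.top :: u.tail.1 :=
  (List.cons_head_tail _).symm

theorem Chain.ext_top_tail {n : ℕ} {u u' : S.Chain (n + 1)} (h : u.top = u'.top)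
    (h' : u.tail = u'.tail) : u = u' :=
  Subtype.ext (by rw [u.cons_top_tail, u'.cons_top_tail, h, h'])

theorem Chain.arrow_top {n : ℕ} (u : S.Chain (n + 2)) : S.Arrow u.tail.top u.top := by
  have h := u.2.2
  rw [u.cons_top_tail, u.tail.cons_top_tail] at h
  exact h.1

/-- If `g' = p g`, the tip at the start of `gf` occurs in `g'f` right after `p`. The only occurrence
there is a prefix, so `p` is empty. -/
theorem Arrow.eq_of_suffix {f g g' : List ι} (h : S.Arrow f g) (h' : S.Arrow f g')
    (hs : g <:+ g') : g = g' := by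
  obtain ⟨-, t, ht, ⟨q, hq⟩, -⟩ := h
  obtain ⟨-, t', -, -, hu⟩ := h'
  obtain ⟨p, rfl⟩ := hs
  rw [(hu p t q ht (by rw [List.append_assoc, List.append_assoc, hq])).1, List.nil_append]

/-- A normal word `r` has at most one factorization `r = v t` for which `t u'` is a path. -/
theorem Chain.eq_of_factorization {n : ℕ} {u u' : S.Chain (n + 2)} {v v' : List ι}
    (ht : u.tail = u'.tail) (h : v ++ u.top = v' ++ u'.top) : u = u' ∧ v = v' := by
  have ha := u.arrow_top
  have ha' := u'.arrow_top
  rw [← ht] at ha'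
  have htop : u.top = u'.top := by
    have h1 : u.top <:+ v ++ u.top := List.suffix_append _ _
    have h2 : u'.top <:+ v ++ u.top := h ▸ List.suffix_append _ _
    rcases List.suffix_or_suffix_of_suffix h1 h2 with hs | hs
    · exact ha.eq_of_suffix ha' hs
    · exact (ha'.eq_of_suffix ha hs).symm
  rw [htop] at h
  exact ⟨Chain.ext_top_tail htop ht, List.append_cancel_right h⟩

variable [Finite ι]

theorem normalBasis_apply (r : S.NormalWord) : S.normalBasis r = S.eval r.1 := by
  simp [normalBasis]

theorem coeff_zero {n : ℕ} (r : S.NormalWord) (u : S.Chain n) : S.coeff 0 r u = 0 := by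
  simp [coeff]

theorem coeff_add {n : ℕ} (x y : S.Free n) (r : S.NormalWord) (u : S.Chain n) :
    S.coeff (x + y) r u = S.coeff x r u + S.coeff y r u := by
  simp [coeff]

theorem coeff_smul {n : ℕ} (c : 𝕜) (x : S.Free n) (r : S.NormalWord) (u : S.Chain n) :
    S.coeff (c • x) r u = c * S.coeff x r u := by
  simp [coeff]

open Classical in
theorem coeff_ten {n : ℕ} (r r' : S.NormalWord) (u u' : S.Chain n) :
    S.coeff (S.ten r.1 u) r' u' = if (r', u') = (r, u) then 1 else 0 := by
  unfold coeff ten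
  rw [← normalBasis_apply]
  by_cases hu : u = u'
  · subst hu
    rw [Finsupp.single_eq_same, Module.Basis.repr_self, Finsupp.single_apply]
    by_cases hr : r = r'
    · simp [hr]
    · rw [if_neg hr, if_neg]
      rintro h
      exact hr (Prod.ext_iff.1 h).1.symm
  · rw [Finsupp.single_eq_of_ne (Ne.symm hu), if_neg]
    · simp
    · intro h
      exact hu (Prod.ext_iff.1 h).2.symm

theorem isHighest_smul_ten {n : ℕ} {c : 𝕜} (hc : c ≠ 0) (r : S.NormalWord) (u : S.Chain n) :
    S.IsHighest (c • S.ten r.1 u) r u := by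
  classical
  refine ⟨by simpa [coeff_smul, coeff_ten] using hc, fun r' u' h hne => ?_⟩
  rw [coeff_smul, coeff_ten, if_neg hne, mul_zero] at h
  exact absurd rfl h

theorem isHighest_add {n : ℕ} {c c' : 𝕜} (hc : c ≠ 0) {r r' : S.NormalWord} {u u' : S.Chain n}
    (hlt : WordLT (r'.1 ++ u'.word) (r.1 ++ u.word)) :
    S.IsHighest (c • S.ten r.1 u + c' • S.ten r'.1 u') r u := by
  classical
  have hne : (r, u) ≠ (r', u') := by
    rintro ⟨⟩
    exact hlt.ne rfl
  refine ⟨?_, fun s v h hs => ?_⟩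
  · simpa [coeff_add, coeff_smul, coeff_ten, hne] using hc
  · by_cases h' : (s, v) = (r', u')
    · cases h'
      exact hlt
    · simp [coeff_add, coeff_smul, coeff_ten, hs, h'] at h

theorem coeff_smul_ten_add {n : ℕ} (c c' : 𝕜) {r r' : S.NormalWord} {u u' : S.Chain n}
    (hlt : WordLT (r'.1 ++ u'.word) (r.1 ++ u.word)) :
    S.coeff (c • S.ten r.1 u + c' • S.ten r'.1 u') r u = c := by
  classical
  have hne : (r, u) ≠ (r', u') := by
    rintro ⟨⟩
    exact hlt.ne rfl
  simp [coeff_add, coeff_smul, coeff_ten, hne]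

theorem IsHighest.unique {n : ℕ} {x : S.Free n} {r r' : S.NormalWord} {u u' : S.Chain n}
    (h : S.IsHighest x r u) (h' : S.IsHighest x r' u') : r = r' ∧ u = u' := by
  by_contra hne
  have hne' : (r, u) ≠ (r', u') := fun e => hne (Prod.ext_iff.1 e)
  exact (h.2 _ _ h'.1 hne'.symm).asymm (h'.2 _ _ h.1 hne')

theorem Reduces.cases_eq {n : ℕ} {d : S.Free (n + 2) →ₗ[A] S.Free (n + 1)} {x : S.Free (n + 1)}
    {z : S.Free (n + 2)} (h : S.Reduces d x z) :
    (x = 0 ∧ z = 0) ∨ ∃ (y : S.Free (n + 2)) (r : S.NormalWord) (v : List ι) (u : S.Chain (n + 2)),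
      r.1 = v ++ u.top ∧ S.IsHighest x r u.tail ∧
        S.Reduces d (x - d (S.coeff x r u.tail • S.ten v u)) y ∧
        z = S.coeff x r u.tail • S.ten v u + y := by
  cases h with
  | zero => exact Or.inl ⟨rfl, rfl⟩
  | step _ y r v u hr hx hy => exact Or.inr ⟨y, r, v, u, hr, hx, hy, rfl⟩

/-- The recursive rule is deterministic. -/
theorem Reduces.unique {n : ℕ} {d : S.Free (n + 2) →ₗ[A] S.Free (n + 1)} {x : S.Free (n + 1)}
    {z z' : S.Free (n + 2)} (h : S.Reduces d x z) (h' : S.Reduces d x z') : z = z' := by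
  induction h generalizing z' with
  | zero =>
    rcases h'.cases_eq with ⟨-, rfl⟩ | ⟨y, r, v, u, -, hx, -⟩
    · rfl
    · exact absurd (coeff_zero _ _) hx.1
  | step x y r v u hr hx hy ih =>
    rcases h'.cases_eq with ⟨rfl, -⟩ | ⟨y', r', v', u', hr', hx', hy', rfl⟩
    · exact absurd (coeff_zero _ _) hx.1
    · obtain ⟨rfl, ht⟩ := hx.unique hx'
      obtain ⟨rfl, rfl⟩ := Chain.eq_of_factorization ht (hr.symm.trans hr')
      rw [ih hy']

/-- `reduce` picks a value by choice; by determinism any explicit trace of the rule identifies it.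
-/
theorem Reduces.reduce_eq {n : ℕ} {d : S.Free (n + 2) →ₗ[A] S.Free (n + 1)} {x : S.Free (n + 1)}
    {z : S.Free (n + 2)} (h : S.Reduces d x z) : S.reduce d x = z := by
  have hex : ∃ y, S.Reduces d x y := ⟨z, h⟩
  rw [reduce, dif_pos hex]
  exact hex.choose_spec.unique h

/-- Not automatic: beyond degree zero `s` is a bare function, with no linearity built in. -/
theorem stage_s_zero (n : ℕ) : (S.stage n).s 0 = 0 := by
  induction n with
  | zero => simp [stage]
  | succ n ih =>
    change S.reduce _ (0 - (S.stage n).s ((S.stage n).d 0)) = 0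
    rw [map_zero, ih, sub_zero]
    exact Reduces.zero.reduce_eq

/-- On cycles the projection `b - s (d b)` to the kernel is the identity. -/
theorem stage_succ_s_of_ker {n : ℕ} {b : S.Free (n + 1)} (hb : (S.stage n).d b = 0) :
    (S.stage (n + 1)).s b = S.reduce (S.stage (n + 1)).d b := by
  change S.reduce _ (b - (S.stage n).s ((S.stage n).d b)) = _
  rw [hb, stage_s_zero, sub_zero]
  rfl

theorem stage_succ_d_single (n : ℕ) (u : S.Chain (n + 2)) :
    (S.stage (n + 1)).d (Finsupp.single u 1) =
      S.ten u.top u.tail - (S.stage n).s ((S.stage n).d (S.ten u.top u.tail)) := by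
  change Finsupp.linearCombination A _ _ = _
  rw [Finsupp.linearCombination_single, one_smul]

theorem stage_zero_d_single (u : S.Chain 1) :
    (S.stage 0).d (Finsupp.single u 1) = S.ten u.top S.nilChain := by
  change Finsupp.linearCombination A _ _ = _
  rw [Finsupp.linearCombination_single, one_smul]

theorem stage_zero_s (x : S.Free 0) : (S.stage 0).s x = S.sZero (x S.nilChain) := rfl

theorem sZero_eval (r : S.NormalWord) : S.sZero (S.eval r.1) = S.sZeroWord r.1 := by
  rw [← normalBasis_apply, sZero, Module.Basis.constr_basis]

/-- A trace of length one: the differential of the lift is exactly the given term, so nothing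
remains. -/
theorem reduces_smul_ten {n : ℕ} {d : S.Free (n + 2) →ₗ[A] S.Free (n + 1)} {c : 𝕜} (hc : c ≠ 0)
    {v : List ι} {u : S.Chain (n + 2)} {r : S.NormalWord} (hr : r.1 = v ++ u.top)
    (hd : d (c • S.ten v u) = c • S.ten r.1 u.tail) :
    S.Reduces d (c • S.ten r.1 u.tail) (c • S.ten v u) := by
  classical
  have hcoeff : S.coeff (c • S.ten r.1 u.tail) r u.tail = c := by
    rw [coeff_smul, coeff_ten, if_pos rfl, mul_one]
  have h := Reduces.step (d := d) (c • S.ten r.1 u.tail) 0 r v u hr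
    (isHighest_smul_ten hc r u.tail) (by rw [hcoeff, hd, sub_self]; exact Reduces.zero)
  rwa [hcoeff, add_zero] at h

/-- One step on a sum of two terms, with the remainder left to `hy`. The boundaries that occur later
never have more than two terms. -/
theorem reduces_add {n : ℕ} {d : S.Free (n + 2) →ₗ[A] S.Free (n + 1)} {c c' : 𝕜}
    (hc : c ≠ 0) {v : List ι} {u : S.Chain (n + 2)} {r r' : S.NormalWord} (hr : r.1 = v ++ u.top)
    {u' : S.Chain (n + 1)} (hlt : WordLT (r'.1 ++ u'.word) (r.1 ++ u.tail.word))
    {y : S.Free (n + 2)}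
    (hy : S.Reduces d (c • S.ten r.1 u.tail + c' • S.ten r'.1 u' - d (c • S.ten v u)) y) :
    S.Reduces d (c • S.ten r.1 u.tail + c' • S.ten r'.1 u') (c • S.ten v u + y) := by
  have hcoeff := coeff_smul_ten_add c c' hlt
  have h := Reduces.step (d := d) _ y r v u hr (isHighest_add (c' := c') hc hlt)
    (by rw [hcoeff]; exact hy)
  rwa [hcoeff] at h

end AugPresentation

/-! ### The total differential in coordinates -/

section TriD

variable {R : Type*} [CommRing R]

/-- The differential of a triple complex with components `R` in which the differentials in the
three directions are multiplications by the elements `y k`, `x j` and `w i`. -/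
def triD (y x w : ℕ → R) (n : ℕ) : (TriDeg (n + 1) → R) →ₗ[R] (TriDeg n → R) where
  toFun f t :=
    y (t.1.2.2 + 1) * f ⟨(t.1.1, t.1.2.1, t.1.2.2 + 1), by have := t.2; simp only; omega⟩ +
    (-1) ^ t.1.2.2 *
      (x (t.1.2.1 + 1) * f ⟨(t.1.1, t.1.2.1 + 1, t.1.2.2), by have := t.2; simp only; omega⟩) +
    (-1) ^ (t.1.2.2 + t.1.2.1) *
      (w (t.1.1 + 1) * f ⟨(t.1.1 + 1, t.1.2.1, t.1.2.2), by have := t.2; simp only; omega⟩)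
  map_add' f g := by ext t; simp only [Pi.add_apply]; ring
  map_smul' c f := by
    ext t; simp only [Pi.smul_apply, smul_eq_mul, RingHom.id_apply]; ring

theorem triD_apply (y x w : ℕ → R) {n i j k : ℕ} (h : i + j + k = n) (f : TriDeg (n + 1) → R) :
    triD y x w n f ⟨(i, j, k), h⟩ =
      y (k + 1) * f ⟨(i, j, k + 1), by simp only; omega⟩ +
      (-1) ^ k * (x (j + 1) * f ⟨(i, j + 1, k), by simp only; omega⟩) +
      (-1) ^ (k + j) * (w (i + 1) * f ⟨(i + 1, j, k), by simp only; omega⟩) := rfl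

/-- In each direction the square vanishes by hypothesis; the mixed terms come in pairs of opposite
sign. -/
theorem triD_triD {y x w : ℕ → R} (hy : ∀ l, y (l + 1) * y l = 0) (hx : ∀ l, x (l + 1) * x l = 0)
    (hw : ∀ l, w (l + 1) * w l = 0) (n : ℕ) (f : TriDeg (n + 2) → R) :
    triD y x w n (triD y x w (n + 1) f) = 0 := by
  ext ⟨⟨i, j, k⟩, h⟩
  simp only [triD_apply, Pi.zero_apply]
  have h1 := hy (k + 1)
  have h2 := hx (j + 1)
  have h3 := hw (i + 1)
  -- The values `a1`, `a4`, `a6` are those where one index is raised twice; the other three each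
  -- occur twice and cancel.
  generalize f _ = a1 at *
  generalize f _ = a2 at *
  generalize f _ = a3 at *
  generalize f _ = a4 at *
  generalize f _ = a5 at *
  generalize f _ = a6 at *
  simp only [pow_succ, pow_add]
  linear_combination (a1) * h1 + (a4 * (-1 : R) ^ k * (-1) ^ k) * h2 +
    (a6 * (-1 : R) ^ k * (-1) ^ k * (-1) ^ j * (-1) ^ j) * h3

end TriD

namespace TruncAnick

variable {𝕜 : Type*} [Field 𝕜] {m : Fin 3 → ℕ} {hm : ∀ a, 2 ≤ m a}

/-! ### The basis of the Anick resolution -/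

variable (𝕜 hm) in
/-- The path `u_{ijk}` as an element of `C_n`. -/
def triChain {n i j k : ℕ} (h : i + j + k = n) : (truncPresentation 𝕜 m hm).Chain n :=
  ⟨triPath m i j k, isChain_triPath h⟩

theorem exists_eq_triChain {n : ℕ} (u : (truncPresentation 𝕜 m hm).Chain n) :
    ∃ (i j k : ℕ) (h : i + j + k = n), u = triChain 𝕜 hm h := by
  obtain ⟨⟨⟨i, j, k⟩, h⟩, hu, -⟩ := (isChain_iff n u.1).1 u.2
  exact ⟨i, j, k, h, Subtype.ext hu⟩

variable (𝕜 hm) in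
/-- The bijection between the triples of sum `n` and `C_n`. -/
noncomputable def chainEquiv (n : ℕ) : TriDeg n ≃ (truncPresentation 𝕜 m hm).Chain n :=
  Equiv.ofBijective (fun t => triChain 𝕜 hm t.2) <| by
    constructor
    · rintro ⟨⟨i, j, k⟩, h⟩ ⟨⟨i', j', k'⟩, h'⟩ he
      obtain ⟨rfl, rfl, rfl⟩ := triPath_injective hm (congrArg Subtype.val he)
      rfl
    · intro u
      obtain ⟨i, j, k, h, rfl⟩ := exists_eq_triChain u
      exact ⟨⟨(i, j, k), h⟩, rfl⟩

instance (n : ℕ) : Finite (TriDeg n) := by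
  refine Finite.of_injective
    (fun t : TriDeg n => ((⟨t.1.1, by have := t.2; omega⟩, ⟨t.1.2.1, by have := t.2; omega⟩,
      ⟨t.1.2.2, by have := t.2; omega⟩) : Fin (n + 1) × Fin (n + 1) × Fin (n + 1))) ?_
  rintro ⟨⟨i, j, k⟩, h⟩ ⟨⟨i', j', k'⟩, h'⟩ he
  simp only [Prod.mk.injEq, Fin.mk.injEq] at he
  obtain ⟨rfl, rfl, rfl⟩ := he
  rfl

variable (𝕜 hm) in
/-- The coordinates on `P_n` with respect to the basis of the `u_{ijk}`. -/
noncomputable def coords (n : ℕ) :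
    (truncPresentation 𝕜 m hm).Free n ≃ₗ[TruncPoly₃ 𝕜 m] (TriDeg n → TruncPoly₃ 𝕜 m) :=
  Finsupp.domLCongr (chainEquiv 𝕜 hm n).symm ≪≫ₗ
    Finsupp.linearEquivFunOnFinite (TruncPoly₃ 𝕜 m) (TruncPoly₃ 𝕜 m) (TriDeg n)

theorem coords_apply {n : ℕ} (x : (truncPresentation 𝕜 m hm).Free n) (t : TriDeg n) :
    coords 𝕜 hm n x t = x (triChain 𝕜 hm t.2) := by
  simp [coords, Finsupp.domLCongr_apply, Finsupp.domCongr_apply, Finsupp.equivMapDomain_apply]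
  rfl

theorem uElt_natCast {n i j k : ℕ} (h : i + j + k = n) :
    uElt 𝕜 m hm n i j k = Finsupp.single (triChain 𝕜 hm h) 1 := by
  rw [uElt, dif_pos]
  · rfl
  · exact ⟨by simp, isChain_triPath h⟩

theorem uElt_eq_zero {n : ℕ} {i j k : ℤ} (h : i < 0 ∨ j < 0 ∨ k < 0) :
    uElt 𝕜 m hm n i j k = 0 := by
  rw [uElt, dif_neg]
  rintro ⟨h', -⟩
  omega

/-- These rules remove the integer indices `i - 1` from the formula: a successor returns to natural
indices, and at `0` the term disappears. -/
theorem uElt_succ_left {n i : ℕ} {j k : ℤ} :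
    uElt 𝕜 m hm n (((i + 1 : ℕ) : ℤ) - 1) j k = uElt 𝕜 m hm n i j k := by
  simp

theorem uElt_succ_mid {n j : ℕ} {i k : ℤ} :
    uElt 𝕜 m hm n i (((j + 1 : ℕ) : ℤ) - 1) k = uElt 𝕜 m hm n i j k := by
  simp

theorem uElt_succ_right {n k : ℕ} {i j : ℤ} :
    uElt 𝕜 m hm n i j (((k + 1 : ℕ) : ℤ) - 1) = uElt 𝕜 m hm n i j k := by
  simp

theorem uElt_pred_left {n : ℕ} {j k : ℤ} :
    uElt 𝕜 m hm n (((0 : ℕ) : ℤ) - 1) j k = 0 := uElt_eq_zero (by omega)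

theorem uElt_pred_mid {n : ℕ} {i k : ℤ} :
    uElt 𝕜 m hm n i (((0 : ℕ) : ℤ) - 1) k = 0 := uElt_eq_zero (by omega)

theorem uElt_pred_right {n : ℕ} {i j : ℤ} :
    uElt 𝕜 m hm n i j (((0 : ℕ) : ℤ) - 1) = 0 := uElt_eq_zero (by omega)

theorem coords_uElt {n : ℕ} (i j k : ℤ) (t : TriDeg n) :
    coords 𝕜 hm n (uElt 𝕜 m hm n i j k) t =
      if (t.1.1 : ℤ) = i ∧ (t.1.2.1 : ℤ) = j ∧ (t.1.2.2 : ℤ) = k then 1 else 0 := by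
  rw [coords_apply, uElt]
  split_ifs with h1 h2 h2
  · obtain ⟨rfl, rfl, rfl⟩ := h2
    exact Finsupp.single_eq_same
  · refine Finsupp.single_eq_of_ne fun he => ?_
    obtain ⟨e1, e2, e3⟩ := triPath_injective hm (congrArg Subtype.val he)
    omega
  · obtain ⟨rfl, rfl, rfl⟩ := h2
    exact absurd ⟨⟨by simp, by simp, by simp⟩, isChain_triPath t.2⟩ h1
  · rfl

/-! ### The formula for the differential -/

/-- The formula for the differential `d_{n+1}`, on the basis elements `u_{ijk}`. -/
def HasFormula {n : ℕ} (d : (truncPresentation 𝕜 m hm).Free (n + 1) →ₗ[TruncPoly₃ 𝕜 m]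
    (truncPresentation 𝕜 m hm).Free n) : Prop :=
  ∀ i j k : ℕ, i + j + k = n + 1 →
    d (uElt 𝕜 m hm (n + 1) i j k) =
        truncVar₃ 𝕜 m 2 ^ truncSigma (m 2) k • uElt 𝕜 m hm n i j ((k : ℤ) - 1) +
        ((-1) ^ k * truncVar₃ 𝕜 m 1 ^ truncSigma (m 1) j) • uElt 𝕜 m hm n i ((j : ℤ) - 1) k +
        ((-1) ^ (j + k) * truncVar₃ 𝕜 m 0 ^ truncSigma (m 0) i) •
          uElt 𝕜 m hm n ((i : ℤ) - 1) j k

variable (𝕜 m) in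
/-- The powers `a ^ σ(l)` of the variable with index `a`. -/
noncomputable def sigmaPow (a : Fin 3) (l : ℕ) : TruncPoly₃ 𝕜 m := truncVar₃ 𝕜 m a ^ truncSigma (m a) l

theorem sigmaPow_succ_mul (hm : ∀ a, 2 ≤ m a) (a : Fin 3) (l : ℕ) :
    sigmaPow 𝕜 m a (l + 1) * sigmaPow 𝕜 m a l = 0 := by
  rw [sigmaPow, sigmaPow, ← pow_add, truncSigma_succ_add (hm a), truncVar₃_pow]

/-- The formula lists the image of each basis element, while `triD` lists the contributions to each
coordinate. By linearity the two are compared on basis elements, where `k - 1 = k'` becomes `k = k'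
+ 1`. -/
theorem HasFormula.coords_eq {n : ℕ} {d : (truncPresentation 𝕜 m hm).Free (n + 1)
    →ₗ[TruncPoly₃ 𝕜 m] (truncPresentation 𝕜 m hm).Free n} (hd : HasFormula d)
    (x : (truncPresentation 𝕜 m hm).Free (n + 1)) :
    coords 𝕜 hm n (d x) = triD (sigmaPow 𝕜 m 2) (sigmaPow 𝕜 m 1) (sigmaPow 𝕜 m 0) n
      (coords 𝕜 hm (n + 1) x) := by
  suffices h : (coords 𝕜 hm n).toLinearMap ∘ₗ d =
      triD (sigmaPow 𝕜 m 2) (sigmaPow 𝕜 m 1) (sigmaPow 𝕜 m 0) n ∘ₗ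
        (coords 𝕜 hm (n + 1)).toLinearMap from LinearMap.congr_fun h x
  refine Finsupp.lhom_ext' fun u => LinearMap.ext_ring ?_
  obtain ⟨i, j, k, h, rfl⟩ := exists_eq_triChain u
  simp only [LinearMap.comp_apply, Finsupp.lsingle_apply, LinearEquiv.coe_coe]
  rw [← uElt_natCast, hd i j k h]
  ext ⟨⟨i', j', k'⟩, h'⟩
  rw [triD_apply]
  simp only [map_add, map_smul, Pi.add_apply, Pi.smul_apply, coords_uElt, smul_eq_mul, sigmaPow,
    mul_ite, mul_one, mul_zero]
  congr 1
  · congr 1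
    · refine ite_congr (by ext; constructor <;> intro h <;> push_cast at * <;> omega)
        (fun h => ?_) (fun _ => rfl)
      obtain rfl : k = k' + 1 := by push_cast at h; omega
      rfl
    · refine ite_congr (by ext; constructor <;> intro h <;> push_cast at * <;> omega)
        (fun h => ?_) (fun _ => rfl)
      obtain rfl : j = j' + 1 := by push_cast at h; omega
      obtain rfl : k = k' := by push_cast at h; omega
      rfl
  · refine ite_congr (by ext; constructor <;> intro h <;> push_cast at * <;> omega)
      (fun h => ?_) (fun _ => rfl)
    obtain rfl : i = i' + 1 := by push_cast at h; omega
    obtain rfl : j = j' := by push_cast at h; omega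
    obtain rfl : k = k' := by push_cast at h; omega
    rw [add_comm k j]

theorem HasFormula.d_d_eq_zero {n : ℕ} {d : (truncPresentation 𝕜 m hm).Free (n + 1)
    →ₗ[TruncPoly₃ 𝕜 m] (truncPresentation 𝕜 m hm).Free n}
    {d' : (truncPresentation 𝕜 m hm).Free (n + 2)
    →ₗ[TruncPoly₃ 𝕜 m] (truncPresentation 𝕜 m hm).Free (n + 1)}
    (hd : HasFormula d) (hd' : HasFormula d') (x : (truncPresentation 𝕜 m hm).Free (n + 2)) :
    d (d' x) = 0 := by
  apply (coords 𝕜 hm n).injective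
  rw [hd.coords_eq, hd'.coords_eq, map_zero,
    triD_triD (sigmaPow_succ_mul hm 2) (sigmaPow_succ_mul hm 1) (sigmaPow_succ_mul hm 0)]

open AugPresentation

/-! ### Sorted words and their order -/

/-- The word `w ^ a x ^ b y ^ c`. -/
def sortedWord (a b c : ℕ) : List (Fin 3) :=
  List.replicate a 0 ++ List.replicate b 1 ++ List.replicate c 2

theorem isNormal_sortedWord {a b c : ℕ} (ha : a < m 0) (hb : b < m 1) (hc : c < m 2) :
    (truncPresentation 𝕜 m hm).IsNormal (sortedWord a b c) := by
  rw [isNormal_iff]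
  refine ⟨?_, fun e => ?_⟩
  · simp only [sortedWord, List.pairwise_append, List.mem_append, List.mem_replicate]
    refine ⟨⟨List.pairwise_replicate.2 (Or.inr le_rfl),
      List.pairwise_replicate.2 (Or.inr le_rfl), ?_⟩,
      List.pairwise_replicate.2 (Or.inr le_rfl), ?_⟩
    · rintro _ ⟨-, rfl⟩ _ ⟨-, rfl⟩; decide
    · rintro _ (⟨-, rfl⟩ | ⟨-, rfl⟩) _ ⟨-, rfl⟩ <;> decide
  · fin_cases e <;> simpa [sortedWord, List.count_replicate]

variable (𝕜 hm) in
/-- The sorted word `w ^ a x ^ b y ^ c` as a normal word. -/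
def normalWord {a b c : ℕ} (ha : a < m 0) (hb : b < m 1) (hc : c < m 2) :
    (truncPresentation 𝕜 m hm).NormalWord :=
  ⟨sortedWord a b c, isNormal_sortedWord ha hb hc⟩

theorem eval_sortedWord (a b c : ℕ) :
    (truncPresentation 𝕜 m hm).eval (sortedWord a b c) =
      truncVar₃ 𝕜 m 0 ^ a * truncVar₃ 𝕜 m 1 ^ b * truncVar₃ 𝕜 m 2 ^ c := by
  simp [eval, sortedWord, truncPresentation, mul_assoc]

theorem smul_smul_free {n : ℕ} (a b : TruncPoly₃ 𝕜 m) (x : (truncPresentation 𝕜 m hm).Free n) :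
    a • b • x = (a * b) • x := by
  module

variable (𝕜 m) in
/-- The element `w ^ a x ^ b y ^ c` of `A`. -/
noncomputable def mono (a b c : ℕ) : TruncPoly₃ 𝕜 m :=
  truncVar₃ 𝕜 m 0 ^ a * truncVar₃ 𝕜 m 1 ^ b * truncVar₃ 𝕜 m 2 ^ c

/-- Translates between the recursive rule, which has scalars in `𝕜` and words, and the formula,
which has coefficients in `A`. -/
theorem smul_ten_sortedWord (e : ℕ) (a b c : ℕ) {n i j k : ℕ} (h : i + j + k = n) :
    ((-1 : 𝕜) ^ e) • (truncPresentation 𝕜 m hm).ten (sortedWord a b c) (triChain 𝕜 hm h) =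
      ((-1) ^ e * mono 𝕜 m a b c) • uElt 𝕜 m hm n i j k := by
  have h1 : ((-1 : 𝕜) ^ e) • mono 𝕜 m a b c = (-1) ^ e * mono 𝕜 m a b c := by
    have : algebraMap 𝕜 (TruncPoly₃ 𝕜 m) ((-1) ^ e) = (-1) ^ e := by
      rw [map_pow, map_neg, map_one]
    rw [← this]
    exact Algebra.smul_def (R := 𝕜) (A := TruncPoly₃ 𝕜 m) _ _
  rw [uElt_natCast h, ten, eval_sortedWord, Finsupp.smul_single_one, ← h1]
  exact Finsupp.smul_single _ _ _

theorem wordLT_append_cons {a c : Fin 3} (hac : a < c) (p : List (Fin 3)) {q q' : List (Fin 3)}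
    (h : q.length = q'.length) : WordLT (p ++ a :: q) (p ++ c :: q') := by
  refine (List.shortlex_def ..).2 (Or.inr ⟨by simp [h], ?_⟩)
  induction p with
  | nil => exact List.Lex.rel hac
  | cons b p ih => exact List.Lex.cons ih

theorem length_flatten_triPath (m : Fin 3 → ℕ) (i j k : ℕ) :
    (triPath m i j k).flatten.length = (powPath 0 (m 0) i).flatten.length +
      (powPath 1 (m 1) j).flatten.length + (powPath 2 (m 2) k).flatten.length := by
  simp only [triPath, List.flatten_append, List.length_append]
  omega

theorem length_flatten_powPath_succ (a : Fin 3) (m l : ℕ) :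
    (powPath a m (l + 1)).flatten.length = truncSigma m (l + 1) + (powPath a m l).flatten.length := by
  simp [powPath]

theorem word_triChain {n i j k : ℕ} (h : i + j + k = n) :
    (triChain 𝕜 hm h).word = (triPath m i j k).flatten := rfl

/-- These are the words of two terms of `d (y ^ c ⊗ u_{i+1,j+1,k})`. They have equal length, because
each moves one block from the path to the coefficient, and they begin with `w` and `x`. -/
theorem wordLT_left_mid {n i j k : ℕ} (c : ℕ) (h : i + (j + 1) + k = n)
    (h' : i + 1 + j + k = n) :
    WordLT (sortedWord (truncSigma (m 0) (i + 1)) 0 c ++ (triChain 𝕜 hm h).word)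
      (sortedWord 0 (truncSigma (m 1) (j + 1)) c ++ (triChain 𝕜 hm h').word) := by
  obtain ⟨e, he⟩ := Nat.exists_eq_succ_of_ne_zero (truncSigma_pos (hm 0) (i + 1)).ne'
  obtain ⟨f, hf⟩ := Nat.exists_eq_succ_of_ne_zero (truncSigma_pos (hm 1) (j + 1)).ne'
  rw [word_triChain, word_triChain, he, hf]
  have := wordLT_append_cons (a := 0) (c := 1) (by decide) []
    (q := List.replicate e 0 ++ List.replicate c 2 ++ (triPath m i (j + 1) k).flatten)
    (q' := List.replicate f 1 ++ List.replicate c 2 ++ (triPath m (i + 1) j k).flatten) (by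
      simp only [List.length_append, List.length_replicate, length_flatten_triPath,
        length_flatten_powPath_succ]
      omega)
  simpa [sortedWord, List.replicate_succ] using this

/-- The same comparison for `d (w ^ a ⊗ u_{i,j+1,k+1})`: after the common prefix `w ^ a` the next
letters are `x` and `y`. -/
theorem wordLT_mid_right {n i j k : ℕ} (a : ℕ) (h : i + j + (k + 1) = n)
    (h' : i + (j + 1) + k = n) :
    WordLT (sortedWord a (truncSigma (m 1) (j + 1)) 0 ++ (triChain 𝕜 hm h).word)
      (sortedWord a 0 (truncSigma (m 2) (k + 1)) ++ (triChain 𝕜 hm h').word) := by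
  obtain ⟨e, he⟩ := Nat.exists_eq_succ_of_ne_zero (truncSigma_pos (hm 1) (j + 1)).ne'
  obtain ⟨f, hf⟩ := Nat.exists_eq_succ_of_ne_zero (truncSigma_pos (hm 2) (k + 1)).ne'
  rw [word_triChain, word_triChain, he, hf]
  have := wordLT_append_cons (a := 1) (c := 2) (by decide) (List.replicate a 0)
    (q := List.replicate e 1 ++ (triPath m i j (k + 1)).flatten)
    (q' := List.replicate f 2 ++ (triPath m i (j + 1) k).flatten) (by
      simp only [List.length_append, List.length_replicate, length_flatten_triPath,
        length_flatten_powPath_succ]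
      omega)
  simpa [sortedWord, List.replicate_succ] using this

/-! ### The homotopy on boundaries -/

section Step

variable {n : ℕ} {d : (truncPresentation 𝕜 m hm).Free (n + 2) →ₗ[TruncPoly₃ 𝕜 m]
  (truncPresentation 𝕜 m hm).Free (n + 1)}

theorem sigmaPow_eq (a : Fin 3) (l : ℕ) :
    truncVar₃ 𝕜 m a ^ truncSigma (m a) l = sigmaPow 𝕜 m a l := rfl

/-- The largest letter `y` ends the sorted coefficient, and its block is the vertex that extends
`u_{ijk}` to `u_{i,j,k+1}`. -/
theorem reduces_right (e : ℕ) {a b i j k : ℕ} (ha : a < m 0) (hb : b < m 1)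
    (h : i + j + k = n + 1)
    (hd : d (mono 𝕜 m a b 0 • uElt 𝕜 m hm (n + 2) i j (k + 1 : ℕ)) =
      mono 𝕜 m a b (truncSigma (m 2) (k + 1)) • uElt 𝕜 m hm (n + 1) i j k) :
    (truncPresentation 𝕜 m hm).Reduces d
      (((-1) ^ e * mono 𝕜 m a b (truncSigma (m 2) (k + 1))) • uElt 𝕜 m hm (n + 1) i j k)
      (((-1) ^ e * mono 𝕜 m a b 0) • uElt 𝕜 m hm (n + 2) i j (k + 1 : ℕ)) := by
  have hu : i + j + (k + 1) = n + 2 := by omega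
  have key := reduces_smul_ten (d := d) (c := (-1 : 𝕜) ^ e) (by simp)
    (v := sortedWord a b 0) (u := triChain 𝕜 hm hu)
    (r := normalWord 𝕜 hm ha hb (truncSigma_lt (hm 2) (k + 1)))
    (by change sortedWord _ _ _ = _ ++ List.replicate _ _; simp [sortedWord])
    (by
      change d _ = _ • ten _ (sortedWord _ _ _) (triChain 𝕜 hm h)
      rw [smul_ten_sortedWord, smul_ten_sortedWord, ← smul_smul_free, ← smul_smul_free, map_smul,
        hd])
  change Reduces _ d (_ • ten _ (sortedWord _ _ _) (triChain 𝕜 hm h)) _ at key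
  rwa [smul_ten_sortedWord, smul_ten_sortedWord] at key

/-- With no `y` in the coefficient or the path, the block that moves into the path is the power of
`x`. -/
theorem reduces_mid (e : ℕ) {a i j : ℕ} (ha : a < m 0) (h : i + j + 0 = n + 1)
    (hd : d (mono 𝕜 m a 0 0 • uElt 𝕜 m hm (n + 2) i (j + 1 : ℕ) (0 : ℕ)) =
      mono 𝕜 m a (truncSigma (m 1) (j + 1)) 0 • uElt 𝕜 m hm (n + 1) i j (0 : ℕ)) :
    (truncPresentation 𝕜 m hm).Reduces d
      (((-1) ^ e * mono 𝕜 m a (truncSigma (m 1) (j + 1)) 0) • uElt 𝕜 m hm (n + 1) i j (0 : ℕ))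
      (((-1) ^ e * mono 𝕜 m a 0 0) • uElt 𝕜 m hm (n + 2) i (j + 1 : ℕ) (0 : ℕ)) := by
  have hu : i + (j + 1) + 0 = n + 2 := by omega
  have key := reduces_smul_ten (d := d) (c := (-1 : 𝕜) ^ e) (by simp)
    (v := sortedWord a 0 0) (u := triChain 𝕜 hm hu)
    (r := normalWord 𝕜 hm ha (truncSigma_lt (hm 1) (j + 1)) (c := 0) (by have := hm 2; omega))
    (by change sortedWord _ _ _ = _ ++ List.replicate _ _; simp [sortedWord])
    (by
      change d _ = _ • ten _ (sortedWord _ _ _) (triChain 𝕜 hm h)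
      rw [smul_ten_sortedWord, smul_ten_sortedWord, ← smul_smul_free, ← smul_smul_free, map_smul,
        hd])
  change Reduces _ d (_ • ten _ (sortedWord _ _ _) (triChain 𝕜 hm h)) _ at key
  rwa [smul_ten_sortedWord, smul_ten_sortedWord] at key

theorem reduces_right_add (e e' : ℕ) {a b i j k a' b' c' i' j' k' : ℕ} (ha : a < m 0) (hb : b < m 1)
    (ha' : a' < m 0) (hb' : b' < m 1) (hc' : c' < m 2)
    (h : i + j + k = n + 1) (h' : i' + j' + k' = n + 1)
    (hlt : WordLT (sortedWord a' b' c' ++ (triChain 𝕜 hm h').word)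
      (sortedWord a b (truncSigma (m 2) (k + 1)) ++ (triChain 𝕜 hm h).word))
    {z : (truncPresentation 𝕜 m hm).Free (n + 2)}
    (hz : (truncPresentation 𝕜 m hm).Reduces d
      (((-1) ^ e * mono 𝕜 m a b (truncSigma (m 2) (k + 1))) • uElt 𝕜 m hm (n + 1) i j k +
        ((-1) ^ e' * mono 𝕜 m a' b' c') • uElt 𝕜 m hm (n + 1) i' j' k' -
        ((-1) ^ e * mono 𝕜 m a b 0) • d (uElt 𝕜 m hm (n + 2) i j (k + 1 : ℕ))) z) :
    (truncPresentation 𝕜 m hm).Reduces d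
      (((-1) ^ e * mono 𝕜 m a b (truncSigma (m 2) (k + 1))) • uElt 𝕜 m hm (n + 1) i j k +
        ((-1) ^ e' * mono 𝕜 m a' b' c') • uElt 𝕜 m hm (n + 1) i' j' k')
      (((-1) ^ e * mono 𝕜 m a b 0) • uElt 𝕜 m hm (n + 2) i j (k + 1 : ℕ) + z) := by
  have hu : i + j + (k + 1) = n + 2 := by omega
  have key := reduces_add (d := d) (c := (-1 : 𝕜) ^ e) (c' := (-1 : 𝕜) ^ e') (by simp)
    (v := sortedWord a b 0) (u := triChain 𝕜 hm hu)
    (r := normalWord 𝕜 hm ha hb (truncSigma_lt (hm 2) (k + 1)))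
    (r' := normalWord 𝕜 hm ha' hb' hc') (u' := triChain 𝕜 hm h')
    (by change sortedWord _ _ _ = _ ++ List.replicate _ _; simp [sortedWord]) hlt (y := z)
    (by
      change Reduces _ d (_ • ten _ (sortedWord _ _ _) (triChain 𝕜 hm h) +
        _ • ten _ (sortedWord _ _ _) (triChain 𝕜 hm h') - _) _
      rwa [smul_ten_sortedWord, smul_ten_sortedWord, smul_ten_sortedWord, map_smul])
  change Reduces _ d (_ • ten _ (sortedWord _ _ _) (triChain 𝕜 hm h) +
        _ • ten _ (sortedWord _ _ _) (triChain 𝕜 hm h')) _ at key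
  rwa [smul_ten_sortedWord, smul_ten_sortedWord, smul_ten_sortedWord] at key

theorem mono_eq_left (i : ℕ) : mono 𝕜 m (truncSigma (m 0) i) 0 0 = sigmaPow 𝕜 m 0 i := by
  simp [mono, sigmaPow]

theorem mono_eq_mid (j : ℕ) : mono 𝕜 m 0 (truncSigma (m 1) j) 0 = sigmaPow 𝕜 m 1 j := by
  simp [mono, sigmaPow]

theorem mono_eq_left_mid (i j : ℕ) : mono 𝕜 m (truncSigma (m 0) i) (truncSigma (m 1) j) 0 =
    sigmaPow 𝕜 m 0 i * sigmaPow 𝕜 m 1 j := by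
  simp [mono, sigmaPow]

theorem mono_eq_left_right (i k : ℕ) : mono 𝕜 m (truncSigma (m 0) i) 0 (truncSigma (m 2) k) =
    sigmaPow 𝕜 m 0 i * sigmaPow 𝕜 m 2 k := by
  simp [mono, sigmaPow]

theorem mono_eq_mid_right (j k : ℕ) : mono 𝕜 m 0 (truncSigma (m 1) j) (truncSigma (m 2) k) =
    sigmaPow 𝕜 m 1 j * sigmaPow 𝕜 m 2 k := by
  simp [mono, sigmaPow]

theorem sigmaPow_smul_smul (a : Fin 3) (l : ℕ) (c : TruncPoly₃ 𝕜 m) {N : ℕ}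
    (x : (truncPresentation 𝕜 m hm).Free N) :
    sigmaPow 𝕜 m a (l + 1) • (c * sigmaPow 𝕜 m a l) • x = 0 := by
  rw [smul_smul_free, mul_left_comm, sigmaPow_succ_mul hm, mul_zero, zero_smul]

/-- The redundant factor `1` gives all three coefficients the shape `c * sigmaPow`, so that
`sigmaPow_smul_smul` can kill any of them. -/
theorem HasFormula.sigmaPow_eq (hd : HasFormula d) {i j k : ℕ} (h : i + j + k = n + 2) :
    d (uElt 𝕜 m hm (n + 2) i j k) =
        (1 * sigmaPow 𝕜 m 2 k) • uElt 𝕜 m hm (n + 1) i j ((k : ℤ) - 1) +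
        ((-1) ^ k * sigmaPow 𝕜 m 1 j) • uElt 𝕜 m hm (n + 1) i ((j : ℤ) - 1) k +
        ((-1) ^ (j + k) * sigmaPow 𝕜 m 0 i) • uElt 𝕜 m hm (n + 1) ((i : ℤ) - 1) j k := by
  rw [hd i j k h, one_mul]
  rfl

/-- The `y` term of the boundary vanishes, leaving an `x` term and a `w` term, of which the `x` term
is higher. Lifting it removes it and creates a multiple of `u_{i-1,j-1,k+1}` with coefficient in `w`
and `x`; the original `w` term is now the highest, and lifting it cancels both. If `i` or `j` is
`0`, at most one lift is needed. -/
theorem reduces_boundary_right (hd : HasFormula d) {i j k : ℕ} (h : i + j + k = n + 2) :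
    (truncPresentation 𝕜 m hm).Reduces d
      (d (sigmaPow 𝕜 m 2 (k + 1) • uElt 𝕜 m hm (n + 2) i j k))
      (((-1) ^ k * sigmaPow 𝕜 m 1 j) • uElt 𝕜 m hm (n + 2) i ((j : ℤ) - 1) (k + 1 : ℕ) +
        ((-1) ^ (j + k) * sigmaPow 𝕜 m 0 i) •
          uElt 𝕜 m hm (n + 2) ((i : ℤ) - 1) j (k + 1 : ℕ)) := by
  rw [map_smul, hd.sigmaPow_eq h, smul_add, smul_add, sigmaPow_smul_smul, zero_add]
  have h0 : 0 < m 0 := by have := hm 0; omega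
  have h1 : 0 < m 1 := by have := hm 1; omega
  have h2 : 0 < m 2 := by have := hm 2; omega
  cases i with
  | zero =>
    cases j with
    | zero =>
      simp only [uElt_pred_left, uElt_pred_mid, smul_zero, add_zero]
      exact Reduces.zero
    | succ j =>
      simp only [uElt_pred_left, uElt_succ_mid, smul_zero, add_zero]
      have key := reduces_right (d := d) k (a := 0) (b := truncSigma (m 1) (j + 1)) (i := 0) (j := j)
        (k := k) h0 (truncSigma_lt (hm 1) _) (by omega) (by
          rw [mono_eq_mid, mono_eq_mid_right, map_smul, hd.sigmaPow_eq (by omega), smul_add,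
            smul_add, sigmaPow_smul_smul, uElt_pred_left, uElt_succ_right, smul_zero, smul_zero]
          module)
      rw [mono_eq_mid, mono_eq_mid_right] at key
      convert key using 1
      module
  | succ i =>
    cases j with
    | zero =>
      simp only [uElt_pred_mid, uElt_succ_left, smul_zero, zero_add]
      have key := reduces_right (d := d) k (a := truncSigma (m 0) (i + 1)) (b := 0) (i := i) (j := 0)
        (k := k) (truncSigma_lt (hm 0) _) h1 (by omega) (by
          rw [mono_eq_left, mono_eq_left_right, map_smul, hd.sigmaPow_eq (by omega), smul_add,
            smul_add, sigmaPow_smul_smul, uElt_pred_mid, uElt_succ_right, smul_zero, smul_zero]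
          module)
      rw [mono_eq_left, mono_eq_left_right] at key
      convert key using 1
      module
    | succ j =>
      simp only [uElt_succ_mid, uElt_succ_left]
      have e1 : ((-1 : TruncPoly₃ 𝕜 m) ^ k) * (-1) ^ k = 1 :=
        pow_mul_pow_eq_one k (by ring)
      -- The second step of the trace. It comes first because a trace is built from its end; its
      -- lower term is the one created by the first step, with sign `(-1) ^ j`.
      have last := reduces_right_add (d := d) (j + 1 + k) j (a := truncSigma (m 0) (i + 1)) (b := 0)
        (i := i) (j := j + 1) (k := k) (a' := truncSigma (m 0) (i + 1))
        (b' := truncSigma (m 1) (j + 1)) (c' := 0) (i' := i) (j' := j) (k' := k + 1)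
        (truncSigma_lt (hm 0) _) h1 (truncSigma_lt (hm 0) _) (truncSigma_lt (hm 1) _) h2
        (by omega) (by omega) (wordLT_mid_right _ _ _) (z := 0) (by
          rw [mono_eq_left, mono_eq_left_right, mono_eq_left_mid, hd.sigmaPow_eq (by omega),
            ← smul_smul_free _ (sigmaPow 𝕜 m 0 (i + 1)) (_ + _)]
          simp only [smul_add, sigmaPow_smul_smul, add_zero]
          rw [uElt_succ_right, uElt_succ_mid]
          refine (congrArg (fun x => Reduces _ d x 0) ?_).mpr Reduces.zero
          match_scalars
          · ring
          · simp only [pow_succ, pow_add]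
            linear_combination (-(-1) ^ j * sigmaPow 𝕜 m 0 (i + 1) * sigmaPow 𝕜 m 1 (j + 1)) * e1)
      rw [mono_eq_left, mono_eq_left_right, mono_eq_left_mid, add_zero] at last
      -- The first step: the `x` term is lifted, and its remainder is the input of `last`.
      have first := reduces_right_add (d := d) k (j + 1 + k) (a := 0) (b := truncSigma (m 1) (j + 1))
        (i := i + 1) (j := j) (k := k) (a' := truncSigma (m 0) (i + 1))
        (b' := 0) (c' := truncSigma (m 2) (k + 1)) (i' := i) (j' := j + 1) (k' := k)
        h0 (truncSigma_lt (hm 1) _) (truncSigma_lt (hm 0) _) h1 (truncSigma_lt (hm 2) _)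
        (by omega) (by omega) (wordLT_left_mid _ _ _) (by
          convert last using 1
          rw [mono_eq_mid, mono_eq_mid_right, mono_eq_left_right, hd.sigmaPow_eq (by omega),
            ← smul_smul_free _ (sigmaPow 𝕜 m 1 (j + 1)) (_ + _)]
          simp only [smul_add, sigmaPow_smul_smul, add_zero]
          rw [uElt_succ_right, uElt_succ_left]
          match_scalars
          · ring
          · ring
          · simp only [pow_succ, pow_add]
            linear_combination ((-1) ^ j * sigmaPow 𝕜 m 0 (i + 1) * sigmaPow 𝕜 m 1 (j + 1)) * e1)
      rw [mono_eq_mid, mono_eq_mid_right, mono_eq_left_right] at first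
      convert first using 1
      module

/-- The `x` term vanishes and there is no `y` term, so only the `w` term has to be lifted. -/
theorem reduces_boundary_mid (hd : HasFormula d) {i j : ℕ} (h : i + j + 0 = n + 2) :
    (truncPresentation 𝕜 m hm).Reduces d
      (d (sigmaPow 𝕜 m 1 (j + 1) • uElt 𝕜 m hm (n + 2) i j (0 : ℕ)))
      (((-1) ^ j * sigmaPow 𝕜 m 0 i) •
          uElt 𝕜 m hm (n + 2) ((i : ℤ) - 1) (j + 1 : ℕ) (0 : ℕ)) := by
  rw [map_smul, hd.sigmaPow_eq h, smul_add, smul_add, sigmaPow_smul_smul, add_zero,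
    uElt_pred_right, smul_zero, smul_zero, zero_add, add_zero]
  cases i with
  | zero =>
    simp only [uElt_pred_left, smul_zero]
    exact Reduces.zero
  | succ i =>
    rw [uElt_succ_left, uElt_succ_left]
    have key := reduces_mid (d := d) j (a := truncSigma (m 0) (i + 1)) (i := i) (j := j)
      (truncSigma_lt (hm 0) _) (by omega) (by
        rw [mono_eq_left, mono_eq_left_mid, map_smul, hd.sigmaPow_eq (by omega), smul_add,
          smul_add, sigmaPow_smul_smul, uElt_pred_right, uElt_succ_mid, smul_zero, smul_zero]
        module)
    rw [mono_eq_left, mono_eq_left_mid] at key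
    convert key using 1
    module

theorem boundary_left (hd : HasFormula d) {i : ℕ} (h : i + 0 + 0 = n + 2) :
    d (sigmaPow 𝕜 m 0 (i + 1) • uElt 𝕜 m hm (n + 2) i (0 : ℕ) (0 : ℕ)) = 0 := by
  rw [map_smul, hd.sigmaPow_eq h, smul_add, smul_add, sigmaPow_smul_smul,
    uElt_pred_right, uElt_pred_mid]
  simp

end Step
/-! ### The differentials of the Anick resolution -/

theorem ten_replicate (a : Fin 3) (l : ℕ) {n i j k : ℕ} (h : i + j + k = n) :
    (truncPresentation 𝕜 m hm).ten (List.replicate (truncSigma (m a) l) a) (triChain 𝕜 hm h) =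
      sigmaPow 𝕜 m a l • uElt 𝕜 m hm n i j k := by
  rw [uElt_natCast h, Finsupp.smul_single_one, ten]
  congr 1
  simp [eval, truncPresentation, sigmaPow]

theorem stage_succ_d_right {n i j k : ℕ} (h : i + j + k = n + 1) :
    ((truncPresentation 𝕜 m hm).stage (n + 1)).d (uElt 𝕜 m hm (n + 2) i j (k + 1 : ℕ)) =
      sigmaPow 𝕜 m 2 (k + 1) • uElt 𝕜 m hm (n + 1) i j k -
        ((truncPresentation 𝕜 m hm).stage n).s (((truncPresentation 𝕜 m hm).stage n).d
          (sigmaPow 𝕜 m 2 (k + 1) • uElt 𝕜 m hm (n + 1) i j k)) := by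
  rw [uElt_natCast (show i + j + (k + 1) = n + 2 by omega), stage_succ_d_single,
    ← ten_replicate 2 (k + 1) h]
  rfl

theorem stage_succ_d_mid {n i j : ℕ} (h : i + j + 0 = n + 1) :
    ((truncPresentation 𝕜 m hm).stage (n + 1)).d (uElt 𝕜 m hm (n + 2) i (j + 1 : ℕ) (0 : ℕ)) =
      sigmaPow 𝕜 m 1 (j + 1) • uElt 𝕜 m hm (n + 1) i j (0 : ℕ) -
        ((truncPresentation 𝕜 m hm).stage n).s (((truncPresentation 𝕜 m hm).stage n).d
          (sigmaPow 𝕜 m 1 (j + 1) • uElt 𝕜 m hm (n + 1) i j (0 : ℕ))) := by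
  rw [uElt_natCast (show i + (j + 1) + 0 = n + 2 by omega), stage_succ_d_single,
    ← ten_replicate 1 (j + 1) h]
  rfl

theorem stage_succ_d_left {n i : ℕ} (h : i + 0 + 0 = n + 1) :
    ((truncPresentation 𝕜 m hm).stage (n + 1)).d
        (uElt 𝕜 m hm (n + 2) (i + 1 : ℕ) (0 : ℕ) (0 : ℕ)) =
      sigmaPow 𝕜 m 0 (i + 1) • uElt 𝕜 m hm (n + 1) i (0 : ℕ) (0 : ℕ) -
        ((truncPresentation 𝕜 m hm).stage n).s (((truncPresentation 𝕜 m hm).stage n).d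
          (sigmaPow 𝕜 m 0 (i + 1) • uElt 𝕜 m hm (n + 1) i (0 : ℕ) (0 : ℕ))) := by
  rw [uElt_natCast (show (i + 1) + 0 + 0 = n + 2 by omega), stage_succ_d_single,
    ← ten_replicate 0 (i + 1) h]
  rfl

theorem triChain_zero : triChain 𝕜 hm (show 0 + 0 + 0 = 0 from rfl) = nilChain _ := rfl

theorem stage_zero_d_left : ((truncPresentation 𝕜 m hm).stage 0).d
    (uElt 𝕜 m hm 1 (1 : ℕ) (0 : ℕ) (0 : ℕ)) =
      sigmaPow 𝕜 m 0 1 • uElt 𝕜 m hm 0 (0 : ℕ) (0 : ℕ) (0 : ℕ) := by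
  rw [uElt_natCast (show 1 + 0 + 0 = 1 from rfl), stage_zero_d_single, ← triChain_zero]
  exact ten_replicate 0 1 _

theorem stage_zero_d_mid : ((truncPresentation 𝕜 m hm).stage 0).d
    (uElt 𝕜 m hm 1 (0 : ℕ) (1 : ℕ) (0 : ℕ)) =
      sigmaPow 𝕜 m 1 1 • uElt 𝕜 m hm 0 (0 : ℕ) (0 : ℕ) (0 : ℕ) := by
  rw [uElt_natCast (show 0 + 1 + 0 = 1 from rfl), stage_zero_d_single, ← triChain_zero]
  exact ten_replicate 1 1 _

theorem stage_zero_d_right : ((truncPresentation 𝕜 m hm).stage 0).d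
    (uElt 𝕜 m hm 1 (0 : ℕ) (0 : ℕ) (1 : ℕ)) =
      sigmaPow 𝕜 m 2 1 • uElt 𝕜 m hm 0 (0 : ℕ) (0 : ℕ) (0 : ℕ) := by
  rw [uElt_natCast (show 0 + 0 + 1 = 1 from rfl), stage_zero_d_single, ← triChain_zero]
  exact ten_replicate 2 1 _

theorem hasFormula_stage_zero : HasFormula ((truncPresentation 𝕜 m hm).stage 0).d := by
  intro i j k h
  have hcases : (i = 1 ∧ j = 0 ∧ k = 0) ∨ (i = 0 ∧ j = 1 ∧ k = 0) ∨ (i = 0 ∧ j = 0 ∧ k = 1) := by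
    omega
  simp only [sigmaPow_eq]
  rcases hcases with ⟨rfl, rfl, rfl⟩ | ⟨rfl, rfl, rfl⟩ | ⟨rfl, rfl, rfl⟩
  · rw [stage_zero_d_left, uElt_pred_mid, uElt_pred_right, uElt_succ_left (i := 0)]
    module
  · rw [stage_zero_d_mid, uElt_pred_left, uElt_pred_right, uElt_succ_mid (j := 0)]
    module
  · rw [stage_zero_d_right, uElt_pred_left, uElt_pred_mid, uElt_succ_right (k := 0)]
    module

theorem stage_zero_s_smul (a : TruncPoly₃ 𝕜 m) :
    ((truncPresentation 𝕜 m hm).stage 0).s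
      (a • uElt 𝕜 m hm 0 (0 : ℕ) (0 : ℕ) (0 : ℕ)) = (truncPresentation 𝕜 m hm).sZero a := by
  rw [uElt_natCast (show 0 + 0 + 0 = 0 from rfl), Finsupp.smul_single_one]
  rw [stage_zero_s, ← triChain_zero, Finsupp.single_eq_same]

/-- For `a < c` the word `ac` is normal, and `s_0` splits off its last letter. -/
theorem sZero_mul {a c : Fin 3} (h : a < c) :
    (truncPresentation 𝕜 m hm).sZero (truncVar₃ 𝕜 m a * truncVar₃ 𝕜 m c) =
      (truncPresentation 𝕜 m hm).ten [a] (letterChain _ c) := by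
  have hn : (truncPresentation 𝕜 m hm).IsNormal [a, c] := by
    rw [isNormal_iff]
    refine ⟨by simpa using h.le, fun b => ?_⟩
    have := hm b
    have h1 : [a, c].Nodup := by simpa using h.ne
    exact (List.nodup_iff_count_le_one.1 h1 b).trans_lt this
  have := sZero_eval (S := truncPresentation 𝕜 m hm) ⟨_, hn⟩
  simpa [eval, sZeroWord, truncPresentation] using this

theorem sZero_sigmaPow_mul {a c : Fin 3} (h : a < c) {i j k : ℕ} (hc : i + j + k = 1)
    (hp : triPath m i j k = [[c]]) :
    (truncPresentation 𝕜 m hm).sZero (sigmaPow 𝕜 m c 1 * sigmaPow 𝕜 m a 1) =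
      sigmaPow 𝕜 m a 1 • uElt 𝕜 m hm 1 i j k := by
  have hl : letterChain _ c = triChain 𝕜 hm hc := Subtype.ext hp.symm
  rw [← ten_replicate a 1 hc, ← hl, mul_comm, sigmaPow, sigmaPow, truncSigma_one, truncSigma_one,
    pow_one, pow_one, sZero_mul h]
  rfl

/-- A separate base case: this differential uses `s_0`, which is defined linearly on normal words
and not by the recursive rule. -/
theorem hasFormula_stage_one : HasFormula ((truncPresentation 𝕜 m hm).stage 1).d := by
  intro i j k h
  simp only [sigmaPow_eq]
  cases k with
  | succ k =>
    have hu : i + j + k = 1 := by omega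
    rw [stage_succ_d_right hu, map_smul]
    have hcases : (i = 1 ∧ j = 0 ∧ k = 0) ∨ (i = 0 ∧ j = 1 ∧ k = 0) ∨
      (i = 0 ∧ j = 0 ∧ k = 1) := by omega
    rcases hcases with ⟨rfl, rfl, rfl⟩ | ⟨rfl, rfl, rfl⟩ | ⟨rfl, rfl, rfl⟩
    · rw [stage_zero_d_left, smul_smul_free, stage_zero_s_smul,
        sZero_sigmaPow_mul (by decide) (show 0 + 0 + 1 = 1 from rfl) (by simp [triPath, powPath]),
        uElt_pred_mid, uElt_succ_left (i := 0), uElt_succ_right (k := 0), smul_zero]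
      module
    · rw [stage_zero_d_mid, smul_smul_free, stage_zero_s_smul,
        sZero_sigmaPow_mul (by decide) (show 0 + 0 + 1 = 1 from rfl) (by simp [triPath, powPath]),
        uElt_pred_left, uElt_succ_mid (j := 0), uElt_succ_right (k := 0), smul_zero]
      module
    · rw [stage_zero_d_right, smul_smul_free, stage_zero_s_smul, sigmaPow_succ_mul hm, map_zero,
        uElt_pred_left, uElt_pred_mid, uElt_succ_right (k := 1), smul_zero, smul_zero]
      module
  | zero =>
    cases j with
    | succ j =>
      have hu : i + j + 0 = 1 := by omega
      rw [stage_succ_d_mid hu, map_smul]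
      have hcases : (i = 1 ∧ j = 0) ∨ (i = 0 ∧ j = 1) := by omega
      rcases hcases with ⟨rfl, rfl⟩ | ⟨rfl, rfl⟩
      · rw [stage_zero_d_left, smul_smul_free, stage_zero_s_smul,
          sZero_sigmaPow_mul (by decide) (show 0 + 1 + 0 = 1 from rfl)
            (by simp [triPath, powPath]),
          uElt_pred_right, uElt_succ_left (i := 0), uElt_succ_mid (j := 0), smul_zero]
        module
      · rw [stage_zero_d_mid, smul_smul_free, stage_zero_s_smul, sigmaPow_succ_mul hm, map_zero,
          uElt_pred_left, uElt_pred_right, uElt_succ_mid (j := 1), smul_zero, smul_zero]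
        module
    | zero =>
      obtain rfl : i = 2 := by omega
      rw [stage_succ_d_left (i := 1) rfl, map_smul, stage_zero_d_left, smul_smul_free,
        stage_zero_s_smul, sigmaPow_succ_mul hm, map_zero, uElt_pred_mid, uElt_pred_right,
        uElt_succ_left (i := 1), smul_zero, smul_zero]
      module

theorem hasFormula_stage (n : ℕ) : HasFormula ((truncPresentation 𝕜 m hm).stage n).d := by
  induction n using Nat.twoStepInduction with
  | zero => exact hasFormula_stage_zero
  | one => exact hasFormula_stage_one
  | more n ih ih' =>
    intro i j k h
    -- Here both induction hypotheses are used: together they make every boundary a cycle, so that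
    -- `s` may be computed by the rule.
    have hker : ∀ x, ((truncPresentation 𝕜 m hm).stage n).d
        (((truncPresentation 𝕜 m hm).stage (n + 1)).d x) = 0 := ih.d_d_eq_zero ih'
    simp only [sigmaPow_eq]
    cases k with
    | succ k =>
      have hu : i + j + k = n + 2 := by omega
      rw [stage_succ_d_right hu, stage_succ_s_of_ker (hker _),
        (reduces_boundary_right ih' hu).reduce_eq, uElt_succ_right]
      simp only [pow_succ, pow_add]
      module
    | zero =>
      cases j with
      | succ j =>
        have hu : i + j + 0 = n + 2 := by omega
        rw [stage_succ_d_mid hu, stage_succ_s_of_ker (hker _),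
          (reduces_boundary_mid ih' hu).reduce_eq, uElt_succ_mid, uElt_pred_right, smul_zero]
        simp only [pow_succ]
        module
      | zero =>
        obtain ⟨i, rfl⟩ : ∃ i', i = i' + 1 := ⟨i - 1, by omega⟩
        have hu : i + 0 + 0 = n + 2 := by omega
        rw [stage_succ_d_left hu, boundary_left ih' hu, stage_s_zero, uElt_succ_left,
          uElt_pred_mid, uElt_pred_right, smul_zero, smul_zero]
        simp

end TruncAnick

/-! ### The periodic resolutions -/

section Periodic

variable (𝕜 : Type*) [Field 𝕜]

theorem truncVar₁_pow (m : ℕ) : truncVar₁ 𝕜 m ^ m = 0 := by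
  have := AdjoinRoot.mk_self (f := (Polynomial.X ^ m : Polynomial 𝕜))
  rwa [map_pow, AdjoinRoot.mk_X] at this

variable {𝕜}

theorem truncVar₁_pow_mul_mk (m q : ℕ) (f : Polynomial 𝕜) :
    truncVar₁ 𝕜 m ^ q * AdjoinRoot.mk _ f = AdjoinRoot.mk _ (Polynomial.X ^ q * f) := by
  rw [map_mul, map_pow, AdjoinRoot.mk_X, truncVar₁]

/-- Lifted to polynomials, `X ^ (p + q)` divides `X ^ q * f` if and only if `X ^ p` divides `f`. -/
theorem exact_mulLeft_truncVar₁_pow {m p q : ℕ} (h : p + q = m) :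
    Function.Exact (LinearMap.mulLeft (TruncPoly₁ 𝕜 m) (truncVar₁ 𝕜 m ^ p))
      (LinearMap.mulLeft (TruncPoly₁ 𝕜 m) (truncVar₁ 𝕜 m ^ q)) := by
  intro b
  obtain ⟨f, rfl⟩ := AdjoinRoot.mk_surjective b
  simp only [LinearMap.mulLeft_apply, Set.mem_range]
  constructor
  · intro hb
    rw [truncVar₁_pow_mul_mk, AdjoinRoot.mk_eq_zero, ← h, add_comm, pow_add,
      mul_dvd_mul_iff_left (pow_ne_zero _ Polynomial.X_ne_zero)] at hb
    obtain ⟨g, rfl⟩ := hb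
    exact ⟨AdjoinRoot.mk _ g, truncVar₁_pow_mul_mk _ _ _⟩
  · rintro ⟨c, hc⟩
    rw [← hc, ← mul_assoc, ← pow_add, add_comm, h, truncVar₁_pow, zero_mul]

theorem truncAug₁_truncVar₁ {m : ℕ} (hm : 2 ≤ m) : truncAug₁ 𝕜 m hm (truncVar₁ 𝕜 m) = 0 := by
  simp [truncAug₁, truncVar₁]

theorem truncAug₁_periodicD {m : ℕ} (hm : 2 ≤ m) (n : ℕ) (b : TruncPoly₁ 𝕜 m) :
    truncAug₁ 𝕜 m hm (periodicD 𝕜 m n b) = 0 := by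
  rw [periodicD, LinearMap.mulLeft_apply, map_mul, map_pow, truncAug₁_truncVar₁,
    zero_pow (truncSigma_pos hm _).ne', zero_mul]

theorem isMinimalResolution_periodicD {m : ℕ} (hm : 2 ≤ m) :
    IsMinimalResolution (periodicD 𝕜 m) (truncAug₁ 𝕜 m hm) := by
  refine ⟨fun c => ⟨algebraMap 𝕜 _ c, (truncAug₁ 𝕜 m hm).commutes c⟩, fun b => ⟨fun hb => ?_, ?_⟩,
    fun n => exact_mulLeft_truncVar₁_pow (truncSigma_succ_add hm (n + 1)),
    truncAug₁_periodicD hm⟩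
  -- The augmentation reads off the constant term, and `σ(1) = 1` makes the first differential
  -- multiplication by the variable.
  · obtain ⟨f, rfl⟩ := AdjoinRoot.mk_surjective b
    have h0 : Polynomial.X ∣ f := by
      rw [Polynomial.X_dvd_iff]
      simpa [truncAug₁] using hb
    obtain ⟨g, rfl⟩ := h0
    refine ⟨AdjoinRoot.mk _ g, ?_⟩
    rw [periodicD, LinearMap.mulLeft_apply, truncSigma_one, truncVar₁_pow_mul_mk, pow_one]
  · rintro ⟨c, rfl⟩
    exact truncAug₁_periodicD hm 0 c

end Periodic

/-! ### The isomorphism of algebras -/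

namespace TruncAnick

variable (𝕜 : Type*) [Field 𝕜] (m : Fin 3 → ℕ)

/-- The images of the variables in `A_y ⊗ A_x ⊗ A_w`. -/
noncomputable def tensorVar : Fin 3 → TruncTensor 𝕜 m :=
  ![(1 ⊗ₜ 1) ⊗ₜ truncVar₁ 𝕜 (m 0), (1 ⊗ₜ truncVar₁ 𝕜 (m 1)) ⊗ₜ 1,
    (truncVar₁ 𝕜 (m 2) ⊗ₜ 1) ⊗ₜ 1]

theorem tensorVar_pow (a : Fin 3) : tensorVar 𝕜 m a ^ m a = 0 := by
  fin_cases a <;>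
    simp [tensorVar, Algebra.TensorProduct.tmul_pow, truncVar₁_pow, TensorProduct.tmul_zero,
      TensorProduct.zero_tmul]

/-- The homomorphism from `𝕜[w,x,y]/(w^{m₁}, x^{m₂}, y^{m₃})` to `A_y ⊗ A_x ⊗ A_w`. -/
noncomputable def toTensor : TruncPoly₃ 𝕜 m →ₐ[𝕜] TruncTensor 𝕜 m :=
  Ideal.Quotient.liftₐ _ (MvPolynomial.aeval (tensorVar 𝕜 m)) (by
    intro p hp
    rw [← RingHom.mem_ker]
    refine Ideal.span_le.2 ?_ hp
    rintro _ ⟨a, rfl⟩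
    simp [RingHom.mem_ker, tensorVar_pow])

theorem toTensor_truncVar₃ (a : Fin 3) : toTensor 𝕜 m (truncVar₃ 𝕜 m a) = tensorVar 𝕜 m a := by
  change MvPolynomial.aeval (tensorVar 𝕜 m) (MvPolynomial.X a) = _
  exact MvPolynomial.aeval_X _ _

/-- The inclusion of the factor with index `a`. -/
noncomputable def factorHom (a : Fin 3) : TruncPoly₁ 𝕜 (m a) →ₐ[𝕜] TruncPoly₃ 𝕜 m :=
  AdjoinRoot.liftAlgHom _ (Algebra.ofId 𝕜 _) (truncVar₃ 𝕜 m a) (by simp [truncVar₃_pow])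

theorem factorHom_truncVar₁ (a : Fin 3) :
    factorHom 𝕜 m a (truncVar₁ 𝕜 (m a)) = truncVar₃ 𝕜 m a := by
  simp [factorHom, truncVar₁]

/-- The homomorphism from `A_y ⊗ A_x ⊗ A_w` to `𝕜[w,x,y]/(w^{m₁}, x^{m₂}, y^{m₃})`. -/
noncomputable def ofTensor : TruncTensor 𝕜 m →ₐ[𝕜] TruncPoly₃ 𝕜 m :=
  Algebra.TensorProduct.productMap
    (Algebra.TensorProduct.productMap (factorHom 𝕜 m 2) (factorHom 𝕜 m 1)) (factorHom 𝕜 m 0)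

theorem ofTensor_tensorVar (a : Fin 3) : ofTensor 𝕜 m (tensorVar 𝕜 m a) = truncVar₃ 𝕜 m a := by
  fin_cases a <;> simp [ofTensor, tensorVar, factorHom_truncVar₁]

variable {𝕜 m} in
theorem truncPoly₃_algHom_ext {B : Type*} [Semiring B] [Algebra 𝕜 B]
    {f g : TruncPoly₃ 𝕜 m →ₐ[𝕜] B} (h : ∀ a, f (truncVar₃ 𝕜 m a) = g (truncVar₃ 𝕜 m a)) :
    f = g :=
  Ideal.Quotient.algHom_ext _ (MvPolynomial.algHom_ext h)

/-- The isomorphism between `𝕜[w,x,y]/(w^{m₁}, x^{m₂}, y^{m₃})` and `A_y ⊗ A_x ⊗ A_w`. -/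
noncomputable def tensorEquiv : TruncPoly₃ 𝕜 m ≃ₐ[𝕜] TruncTensor 𝕜 m :=
  AlgEquiv.ofAlgHom (toTensor 𝕜 m) (ofTensor 𝕜 m)
    (by
      have h : ∀ a, toTensor 𝕜 m (ofTensor 𝕜 m (tensorVar 𝕜 m a)) = tensorVar 𝕜 m a := fun a => by
        rw [ofTensor_tensorVar, toTensor_truncVar₃]
      refine Algebra.TensorProduct.ext (Algebra.TensorProduct.ext ?_ ?_) ?_ <;>
        refine AdjoinRoot.algHom_ext ?_
      · exact h 2
      · exact h 1
      · exact h 0)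
    (by
      refine truncPoly₃_algHom_ext fun a => ?_
      change ofTensor 𝕜 m (toTensor 𝕜 m _) = _
      rw [toTensor_truncVar₃, ofTensor_tensorVar]
      rfl)

theorem tensorEquiv_truncVar₃ (a : Fin 3) :
    tensorEquiv 𝕜 m (truncVar₃ 𝕜 m a) = tensorVar 𝕜 m a := toTensor_truncVar₃ 𝕜 m a

/-! ### The tensor product of the periodic resolutions -/

variable {𝕜 m}

/-- The powers `a ^ σ(l)` in `A_y ⊗ A_x ⊗ A_w`. -/
noncomputable def tensorSigmaPow (a : Fin 3) (l : ℕ) : TruncTensor 𝕜 m :=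
  tensorVar 𝕜 m a ^ truncSigma (m a) l

theorem tensorEquiv_sigmaPow (a : Fin 3) (l : ℕ) :
    tensorEquiv 𝕜 m (sigmaPow 𝕜 m a l) = tensorSigmaPow a l := by
  rw [sigmaPow, map_pow, tensorEquiv_truncVar₃, tensorSigmaPow]

theorem tensorSigmaPow_succ_mul (hm : ∀ a, 2 ≤ m a) (a : Fin 3) (l : ℕ) :
    (tensorSigmaPow a (l + 1) * tensorSigmaPow a l : TruncTensor 𝕜 m) = 0 := by
  rw [tensorSigmaPow, tensorSigmaPow, ← pow_add, truncSigma_succ_add (hm a), tensorVar_pow]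

/-- Each partial differential is multiplication by an element of the tensor algebra, as is seen on
pure tensors. -/
theorem map_periodicD_right (l : ℕ) (x : TruncTensor 𝕜 m) :
    TensorProduct.map (TensorProduct.map ((periodicD 𝕜 (m 2) l).restrictScalars 𝕜) LinearMap.id)
      LinearMap.id x = tensorSigmaPow 2 (l + 1) * x := by
  suffices h : TensorProduct.map (TensorProduct.map ((periodicD 𝕜 (m 2) l).restrictScalars 𝕜)
      LinearMap.id) LinearMap.id =
        LinearMap.mulLeft 𝕜 (tensorSigmaPow 2 (l + 1) : TruncTensor 𝕜 m) from
    LinearMap.congr_fun h x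
  refine TensorProduct.ext_threefold fun a b c => ?_
  simp [periodicD, tensorSigmaPow, tensorVar, Algebra.TensorProduct.tmul_pow]

theorem map_periodicD_mid (l : ℕ) (x : TruncTensor 𝕜 m) :
    TensorProduct.map (TensorProduct.map LinearMap.id ((periodicD 𝕜 (m 1) l).restrictScalars 𝕜))
      LinearMap.id x = tensorSigmaPow 1 (l + 1) * x := by
  suffices h : TensorProduct.map (TensorProduct.map LinearMap.id
      ((periodicD 𝕜 (m 1) l).restrictScalars 𝕜)) LinearMap.id =
        LinearMap.mulLeft 𝕜 (tensorSigmaPow 1 (l + 1) : TruncTensor 𝕜 m) from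
    LinearMap.congr_fun h x
  refine TensorProduct.ext_threefold fun a b c => ?_
  simp [periodicD, tensorSigmaPow, tensorVar, Algebra.TensorProduct.tmul_pow]

theorem map_periodicD_left (l : ℕ) (x : TruncTensor 𝕜 m) :
    TensorProduct.map (TensorProduct.map LinearMap.id LinearMap.id)
      ((periodicD 𝕜 (m 0) l).restrictScalars 𝕜) x = tensorSigmaPow 0 (l + 1) * x := by
  suffices h : TensorProduct.map (TensorProduct.map LinearMap.id LinearMap.id)
      ((periodicD 𝕜 (m 0) l).restrictScalars 𝕜) =
        LinearMap.mulLeft 𝕜 (tensorSigmaPow 0 (l + 1) : TruncTensor 𝕜 m) from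
    LinearMap.congr_fun h x
  refine TensorProduct.ext_threefold fun a b c => ?_
  simp [periodicD, tensorSigmaPow, tensorVar, Algebra.TensorProduct.tmul_pow]

theorem KD_eq_triD (n : ℕ) (x : KMod 𝕜 m (n + 1)) :
    KD 𝕜 m n x = triD (tensorSigmaPow 2) (tensorSigmaPow 1) (tensorSigmaPow 0) n x := by
  have hs : ∀ (e : ℕ) (z : TruncTensor 𝕜 m), (-1 : 𝕜) ^ e • z = (-1) ^ e * z := fun e z => by
    have : algebraMap 𝕜 (TruncTensor 𝕜 m) ((-1) ^ e) = (-1) ^ e := by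
      rw [map_pow, map_neg, map_one]
    rw [← this]
    exact Algebra.smul_def (R := 𝕜) (A := TruncTensor 𝕜 m) _ _
  ext ⟨⟨i, j, k⟩, h⟩
  rw [triD_apply, ← hs, ← hs, ← map_periodicD_right, ← map_periodicD_mid, ← map_periodicD_left]
  rfl

/-- This is what turns an isomorphism of algebras into one of complexes: only the entries of the two
differentials need to correspond. -/
theorem triD_map {R R' : Type*} [CommRing R] [CommRing R'] (f : R →+* R') (y x w : ℕ → R) (n : ℕ)
    (g : TriDeg (n + 1) → R) (t : TriDeg n) :
    f (triD y x w n g t) =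
      triD (fun l => f (y l)) (fun l => f (x l)) (fun l => f (w l)) n (fun s => f (g s)) t := by
  obtain ⟨⟨i, j, k⟩, h⟩ := t
  simp only [triD_apply, map_add, map_mul, map_pow, map_neg, map_one]

/-- The augmentation of `A_y ⊗ A_x ⊗ A_w`. -/
noncomputable def tensorAug (hm : ∀ a, 2 ≤ m a) : TruncTensor 𝕜 m →ₐ[𝕜] 𝕜 :=
  Algebra.TensorProduct.productMap
    (Algebra.TensorProduct.productMap (truncAug₁ 𝕜 (m 2) (hm 2)) (truncAug₁ 𝕜 (m 1) (hm 1)))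
    (truncAug₁ 𝕜 (m 0) (hm 0))

theorem tensorAug_tensorVar (hm : ∀ a, 2 ≤ m a) (a : Fin 3) :
    tensorAug hm (tensorVar 𝕜 m a) = 0 := by
  fin_cases a <;> simp [tensorAug, tensorVar, truncAug₁_truncVar₁]

theorem tensorAug_tensorSigmaPow (hm : ∀ a, 2 ≤ m a) (a : Fin 3) (l : ℕ) :
    tensorAug hm (tensorSigmaPow a l : TruncTensor 𝕜 m) = 0 := by
  rw [tensorSigmaPow, map_pow, tensorAug_tensorVar, zero_pow (truncSigma_pos (hm a) l).ne']

theorem KAug_apply (hm : ∀ a, 2 ≤ m a) (x : KMod 𝕜 m 0) :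
    KAug 𝕜 m hm x = tensorAug hm (x ⟨(0, 0, 0), rfl⟩) := by
  have h : LinearMap.mul' 𝕜 𝕜 ∘ₗ TensorProduct.map (LinearMap.mul' 𝕜 𝕜 ∘ₗ
      TensorProduct.map (truncAug₁ 𝕜 (m 2) (hm 2)).toLinearMap
        (truncAug₁ 𝕜 (m 1) (hm 1)).toLinearMap) (truncAug₁ 𝕜 (m 0) (hm 0)).toLinearMap =
      (tensorAug (𝕜 := 𝕜) hm).toLinearMap := by
    refine TensorProduct.ext_threefold fun a b c => ?_
    simp [tensorAug]
  exact LinearMap.congr_fun h _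

theorem KAug_KD (hm : ∀ a, 2 ≤ m a) (x : KMod 𝕜 m 1) : KAug 𝕜 m hm (KD 𝕜 m 0 x) = 0 := by
  rw [KAug_apply, KD_eq_triD, triD_apply]
  simp only [map_add, map_mul, tensorAug_tensorSigmaPow, zero_mul, mul_zero, add_zero]

theorem tensorAug_tensorEquiv (hm : ∀ a, 2 ≤ m a) (a : TruncPoly₃ 𝕜 m) :
    tensorAug hm (tensorEquiv 𝕜 m a) = (truncPresentation 𝕜 m hm).aug a := by
  have h : (tensorAug hm).comp (tensorEquiv 𝕜 m).toAlgHom = (truncPresentation 𝕜 m hm).aug := by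
    refine truncPoly₃_algHom_ext fun a => ?_
    have h1 := (truncPresentation 𝕜 m hm).aug_gen a
    change _ = (truncPresentation 𝕜 m hm).aug ((truncPresentation 𝕜 m hm).gen a)
    rw [h1]
    change tensorAug hm (tensorEquiv 𝕜 m _) = 0
    rw [tensorEquiv_truncVar₃, tensorAug_tensorVar]
  exact DFunLike.congr_fun h a

/-! ### The comparison isomorphism -/

variable (𝕜) in
/-- The isomorphism from the Anick resolution to the tensor product of the periodic resolutions. -/
noncomputable def anickEquiv (hm : ∀ a, 2 ≤ m a) (n : ℕ) :
    (truncPresentation 𝕜 m hm).Free n ≃+ KMod 𝕜 m n :=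
  (coords 𝕜 hm n).toAddEquiv.trans
    (AddEquiv.piCongrRight fun _ => (tensorEquiv 𝕜 m).toRingEquiv.toAddEquiv)

theorem anickEquiv_apply (hm : ∀ a, 2 ≤ m a) (n : ℕ) (x : (truncPresentation 𝕜 m hm).Free n)
    (t : TriDeg n) : anickEquiv 𝕜 hm n x t = tensorEquiv 𝕜 m (coords 𝕜 hm n x t) := rfl

theorem anickEquiv_smul (hm : ∀ a, 2 ≤ m a) (n : ℕ) (a : TruncPoly₃ 𝕜 m)
    (x : (truncPresentation 𝕜 m hm).Free n) :
    anickEquiv 𝕜 hm n (a • x) = tensorEquiv 𝕜 m a • anickEquiv 𝕜 hm n x := by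
  ext t
  rw [anickEquiv_apply, map_smul, Pi.smul_apply, Pi.smul_apply, anickEquiv_apply, smul_eq_mul,
    smul_eq_mul, map_mul]

theorem anickEquiv_anickD (hm : ∀ a, 2 ≤ m a) (n : ℕ)
    (x : (truncPresentation 𝕜 m hm).Free (n + 1)) :
    anickEquiv 𝕜 hm n ((truncPresentation 𝕜 m hm).anickD n x) =
      KD 𝕜 m n (anickEquiv 𝕜 hm (n + 1) x) := by
  ext t
  rw [anickEquiv_apply, AugPresentation.anickD, (hasFormula_stage n).coords_eq, KD_eq_triD]
  refine (triD_map (tensorEquiv 𝕜 m).toRingEquiv.toRingHom _ _ _ n _ t).trans ?_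
  have hs : ∀ a, (fun l => (tensorEquiv 𝕜 m).toRingEquiv.toRingHom (sigmaPow 𝕜 m a l)) =
      tensorSigmaPow a := fun a => funext (tensorEquiv_sigmaPow a)
  rw [hs, hs, hs]
  rfl

theorem KAug_anickEquiv (hm : ∀ a, 2 ≤ m a) (x : (truncPresentation 𝕜 m hm).Free 0) :
    KAug 𝕜 m hm (anickEquiv 𝕜 hm 0 x) = (truncPresentation 𝕜 m hm).anickAug x := by
  rw [KAug_apply, anickEquiv_apply, tensorAug_tensorEquiv, coords_apply]
  rfl

end TruncAnick

theorem mainTheorem5 {𝕜 : Type*} [Field 𝕜] (m : Fin 3 → ℕ) (hm : ∀ a, 2 ≤ m a) :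
    -- the elements of `C_n` are the paths `u_{ijk}` with `i + j + k = n`, each exactly once
    (∀ (n : ℕ) (p : List (List (Fin 3))), (truncPresentation 𝕜 m hm).IsChain n p ↔
      ∃! t : TriDeg n, p = triPath m t.1.1 t.1.2.1 t.1.2.2) ∧
    -- the differentials of the Anick resolution
    (∀ n i j k : ℕ, i + j + k = n + 1 →
      (truncPresentation 𝕜 m hm).anickD n (uElt 𝕜 m hm (n + 1) i j k) =
        truncVar₃ 𝕜 m 2 ^ truncSigma (m 2) k • uElt 𝕜 m hm n i j ((k : ℤ) - 1) +
        ((-1) ^ k * truncVar₃ 𝕜 m 1 ^ truncSigma (m 1) j) • uElt 𝕜 m hm n i ((j : ℤ) - 1) k +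
        ((-1) ^ (j + k) * truncVar₃ 𝕜 m 0 ^ truncSigma (m 0) i) •
          uElt 𝕜 m hm n ((i : ℤ) - 1) j k) ∧
    -- the Anick resolution is an augmented complex
    (∀ n x, (truncPresentation 𝕜 m hm).anickD n ((truncPresentation 𝕜 m hm).anickD (n + 1) x) = 0) ∧
    (∀ x, (truncPresentation 𝕜 m hm).anickAug ((truncPresentation 𝕜 m hm).anickD 0 x) = 0) ∧
    -- the periodic complexes of the three factors are minimal resolutions
    (∀ a, IsMinimalResolution (periodicD 𝕜 (m a)) (truncAug₁ 𝕜 (m a) (hm a))) ∧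
    -- their tensor product is an augmented complex
    (∀ n x, KD 𝕜 m n (KD 𝕜 m (n + 1) x) = 0) ∧ (∀ x, KAug 𝕜 m hm (KD 𝕜 m 0 x) = 0) ∧
    -- `A ≅ A_y ⊗ A_x ⊗ A_w`, and along this isomorphism the Anick resolution is isomorphic to the
    -- tensor product, by a chain map that lifts the identity of `𝕜`
    ∃ θ : TruncPoly₃ 𝕜 m ≃ₐ[𝕜] TruncTensor 𝕜 m,
      θ (truncVar₃ 𝕜 m 0) = (1 ⊗ₜ 1) ⊗ₜ truncVar₁ 𝕜 (m 0) ∧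
      θ (truncVar₃ 𝕜 m 1) = (1 ⊗ₜ truncVar₁ 𝕜 (m 1)) ⊗ₜ 1 ∧
      θ (truncVar₃ 𝕜 m 2) = (truncVar₁ 𝕜 (m 2) ⊗ₜ 1) ⊗ₜ 1 ∧
      ∃ ψ : ∀ n, (truncPresentation 𝕜 m hm).Free n ≃+ KMod 𝕜 m n,
        (∀ n (a : TruncPoly₃ 𝕜 m) x, ψ n (a • x) = θ a • ψ n x) ∧
        (∀ n x, ψ n ((truncPresentation 𝕜 m hm).anickD n x) = KD 𝕜 m n (ψ (n + 1) x)) ∧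
        (∀ x, KAug 𝕜 m hm (ψ 0 x) = (truncPresentation 𝕜 m hm).anickAug x) := by
  open TruncAnick in
  refine ⟨isChain_iff, hasFormula_stage,
    fun n => (hasFormula_stage n).d_d_eq_zero (hasFormula_stage (n + 1)), fun x => ?_,
    fun a => isMinimalResolution_periodicD (hm a), fun n x => ?_, KAug_KD hm,
    tensorEquiv 𝕜 m, tensorEquiv_truncVar₃ 𝕜 m 0, tensorEquiv_truncVar₃ 𝕜 m 1,
    tensorEquiv_truncVar₃ 𝕜 m 2, anickEquiv 𝕜 hm, anickEquiv_smul hm, anickEquiv_anickD hm,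
    KAug_anickEquiv hm⟩
  -- The augmentation condition is carried back from the tensor product along the chain isomorphism.
  · rw [← KAug_anickEquiv, anickEquiv_anickD, KAug_KD]
  · rw [KD_eq_triD, KD_eq_triD, triD_triD (tensorSigmaPow_succ_mul hm 2)
      (tensorSigmaPow_succ_mul hm 1) (tensorSigmaPow_succ_mul hm 0)]
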